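/- Let $\mathfrak g$ be a complex simple Lie algebra with Cartan subalgebra $\mathfrak t$, root system $\Delta$, simple roots $\Pi$, positive roots $\Delta^+$, highest root $\theta$, Weyl group $W$, and Borel subalgebra $\mathfrak b=\mathfrak t\oplus\bigoplus_{\gamma\in\Delta^+}\mathfrak g_\gamma$. Let $V=\mathbb R\Delta$ with a $W$-invariant inner product $(\cdot,\cdot)$, and extend it to $\widehat V=V\oplus\mathbb R\delta\oplus\mathbb R\lambda$ by $(\delta,V)=(\lambda,V)=(\delta,\delta)=(\lambda,\lambda)=0$, $(\delta,\lambda)=1$. Let $\alpha_0=\delta-\theta$, let $\widehat\Delta^+=\Delta^+\cup\{\gamma+k\delta\mid \gamma\in\Delta,\ k\ge 1\}$, and let $\widehat W\subset GL(\widehat V)$ be generated by the reflections in $\Pi\cup\{\alpha_0\}$. The minuscule element $w_{\mathfrak a}\in\widehat W$ of an abelian ideal $\mathfrak a$ of $\mathfrak b$ is the element whose inversion set $\{\nu\in\widehat\Delta^+\mid w_{\mathfrak a}(\nu)\in-\widehat\Delta^+\}$ equals $\{\delta-\gamma\mid \gamma\in\Delta^+,\ \mathfrak g_\gamma\subset\mathfrak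 a\}$; if $\mathfrak a\neq0$, the rootlet of $\mathfrak a$ is $w_{\mathfrak a}(2\delta-\theta)$. Let $\mu$ be a long positive root (every root being long if $\Delta$ is simply laced). Then there is a unique element $w_\mu\in W$ of minimal length with $w_\mu(\theta)=\mu$, and the set of nonzero abelian ideals of $\mathfrak b$ with rootlet $\mu$ has a least element $\mathfrak a(\mu)_{\min}$ with respect to inclusion. Let $\Pi[\mu]_{\min}\subset\Pi$ be the set of simple roots of the standard Levi subalgebra (the one containing $\mathfrak t$) of the normaliser of $\mathfrak a(\mu)_{\min}$ in $\mathfrak g$. Then: (i) $\Pi[\mu]_{\min}\cap\theta^\perp=\{w_\mu^{-1}(\beta)\mid\beta\in\Pi,\ (\beta,\mu)=0\}=\{\alpha\in\Pi\mid w_\mu(\alpha)\in\Pi,\ (\alpha,\theta)=0\}$. (ii) If $(\mu,\theta)=0$, then $\Pi[\mu]_{\min}=\{w_\mu^{-1}(\beta)\mid\beta\in\Pi,\ (\beta,\mu)=0\}$; in particular $\Pi[\mu]_{\min}\subset\theta^\perp$. (iii) Suppose $(\mu,\theta)\ne0$ and $\mu\neq\theta$. (a) If $\theta$ is a fundamental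 weight, then there is exactly one $\alpha_\theta\in\Pi$ with $(\theta,\alpha_\theta)\neq0$, and $\Pi[\mu]_{\min}=\{\alpha_\theta\}\cup\{w_\mu^{-1}(\beta)\mid\beta\in\Pi,\ (\beta,\mu)=0\}$. (b) $\Delta$ is not of type $C_n$, that is, in type $C_n$ there is no such $\mu$. (c) Let $\Delta$ be of type $A_n$, with $\Pi=\{\alpha_1,\dots,\alpha_n\}$ in the standard numbering. If $\mu=\alpha_1+\dots+\alpha_i$ with $1\le i<n$, then $$\Pi[\mu]_{\min}=\{\alpha_n\}\cup\{w_\mu^{-1}(\beta)\mid\beta\in\Pi,\ (\beta,\mu)=0\}=\Pi\setminus\{\alpha_1,\alpha_i\}.$$ If $\mu=\alpha_j+\dots+\alpha_n$ with $1<j\le n$, then $$\Pi[\mu]_{\min}=\{\alpha_1\}\cup\{w_\mu^{-1}(\beta)\mid\beta\in\Pi,\ (\beta,\mu)=0\}=\Pi\setminus\{\alpha_j,\alpha_n\}.$$ (iv) If $\mu=\theta$, then $\Pi[\mu]_{\min}=\{\beta\in\Pi\mid(\beta,\theta)=0\}$. -/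

import Mathlib

noncomputable section

namespace AbelianIdealNormaliser

open LieAlgebra LieAlgebra.IsKilling

variable {L : Type*} [LieRing L] [LieAlgebra ℂ L] [FiniteDimensional ℂ L] [IsKilling ℂ L]
  (H : LieSubalgebra ℂ L) [H.IsCartanSubalgebra]

instance instIsValuedInReal : (rootSystem H).IsValuedIn ℝ where
  exists_value i j := by
    obtain ⟨z, hz⟩ := RootPairing.IsValuedIn.exists_value (P := rootSystem H) (S := ℤ) i j
    exact ⟨(z : ℝ), by simpa using hz⟩

/-! ### The Euclidean space spanned by the roots

Roots are indexed by `H.root`; a simple system is a base `b` of the root system, with set of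
simple roots `b.support`, and a root `γ` is positive when `b.IsPos γ`. -/

/-- `V`, the real span of the roots inside the dual of the Cartan subalgebra. -/
abbrev V : Type _ := (rootSystem H).rootSpan ℝ

variable {H}

/-- A root, as a vector of `V`. -/
def rootVec (γ : H.root) : V H := (rootSystem H).rootSpanMem ℝ γ

/-- The canonical Weyl-invariant inner product of `V`: `(x, y) = ∑ γ, ⟨x, γ^∨⟩ ⟨y, γ^∨⟩`.
(An invariant inner product of an irreducible root system is unique up to a positive factor.) -/
def ip (x y : V H) : ℝ := (rootSystem H).RootFormIn ℝ x y

/-- The inner product of two roots. -/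
def rootIp (γ ν : H.root) : ℝ := ip (rootVec γ) (rootVec ν)

/-- A root is long if no root has larger length. -/
def IsLong (γ : H.root) : Prop := ∀ ν : H.root, rootIp ν ν ≤ rootIp γ γ

/-- The root order: `γ ≼ ν` if `ν - γ` is a sum of simple roots. -/
def RootLE (b : (rootSystem H).Base) (γ ν : H.root) : Prop :=
  (rootSystem H).root ν - (rootSystem H).root γ ∈
    AddSubmonoid.closure ((rootSystem H).root '' (b.support : Set H.root))

/-- `θ` is the highest root: the greatest positive root. -/
def IsHighestRoot (b : (rootSystem H).Base) (θ : H.root) : Prop :=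
  b.IsPos θ ∧ ∀ γ : H.root, b.IsPos γ → RootLE b γ θ

/-- The root `θ` is a fundamental weight: it pairs to `1` with one simple coroot and to `0` with
all the others. -/
def IsFundamental (b : (rootSystem H).Base) (θ : H.root) : Prop :=
  ∃ α ∈ b.support, (rootSystem H).pairingIn ℤ θ α = 1 ∧
    ∀ β ∈ b.support, β ≠ α → (rootSystem H).pairingIn ℤ θ β = 0

/-- The numbering `e` of the simple roots has Cartan matrix `A`, with
`A k l = ⟨α_k, α_l^∨⟩`. -/
def HasCartanMatrix (b : (rootSystem H).Base) {n : ℕ} (A : Matrix (Fin n) (Fin n) ℤ)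
    (e : Fin n ≃ b.support) : Prop :=
  ∀ k l : Fin n, (rootSystem H).pairingIn ℤ (e k).1 (e l).1 = A k l

/-! ### The Weyl group -/

/-- The Weyl group acting on (the indices of) the roots. -/
def act (w : (rootSystem H).weylGroup) (γ : H.root) : H.root :=
  (rootSystem H).weylGroupToPerm w γ

/-- The length of `w`: the least number of factors in an expression of `w` as a product of simple
reflections. -/
def length (b : (rootSystem H).Base) (w : (rootSystem H).weylGroup) : ℕ :=
  sInf {n : ℕ | ∃ l : List H.root, (∀ α ∈ l, α ∈ b.support) ∧ l.length = n ∧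
    (l.map (RootPairing.weylGroup.ofIdx (rootSystem H))).prod = w}

/-- `w` takes `θ` to `μ` and has minimal length among all such elements of the Weyl group. -/
def IsMinimalTo (b : (rootSystem H).Base) (θ μ : H.root) (w : (rootSystem H).weylGroup) : Prop :=
  act w θ = μ ∧ ∀ w' : (rootSystem H).weylGroup, act w' θ = μ → length b w ≤ length b w'

/-! ### The affine root system and the affine Weyl group -/

variable (H) in
/-- `V ⊕ ℝδ ⊕ ℝλ`; the triple `(v, s, t)` stands for `v + sδ + tλ`. -/
abbrev AffV : Type _ := V H × ℝ × ℝ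

/-- The extended form: `(δ, V) = (λ, V) = (δ, δ) = (λ, λ) = 0` and `(δ, λ) = 1`. -/
def affIp (x y : AffV H) : ℝ := ip x.1 y.1 + x.2.1 * y.2.2 + x.2.2 * y.2.1

/-- The vector `γ + kδ`. -/
def affRoot (γ : H.root) (k : ℤ) : AffV H := (rootVec γ, (k : ℝ), 0)

/-- The positive affine roots: positive roots, and all `γ + kδ` with `k ≥ 1`. -/
def affPos (b : (rootSystem H).Base) : Set (AffV H) :=
  {x | ∃ (γ : H.root) (k : ℤ), x = affRoot γ k ∧ (1 ≤ k ∨ (k = 0 ∧ b.IsPos γ))}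

variable (H) in
/-- The imaginary root `δ`. -/
def delta : AffV H := (0, 1, 0)

/-- A root, as a vector of `V ⊕ ℝδ ⊕ ℝλ`. -/
def emb (γ : H.root) : AffV H := (rootVec γ, 0, 0)

/-- The affine simple roots: the simple roots and `α₀ = δ - θ`. -/
def affSimple (b : (rootSystem H).Base) (θ : H.root) : Set (AffV H) :=
  emb '' (b.support : Set H.root) ∪ {delta H - emb θ}

/-- The affine Weyl group: the subgroup of `GL(V ⊕ ℝδ ⊕ ℝλ)` generated by the reflections
`x ↦ x - (x, α) α^∨`, where `α` is an affine simple root and `α^∨ = 2α / (α, α)`. -/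
def affWeyl (b : (rootSystem H).Base) (θ : H.root) : Subgroup (AffV H ≃ₗ[ℝ] AffV H) :=
  Subgroup.closure {g | ∃ α ∈ affSimple b θ,
    ∀ x : AffV H, g x = x - affIp x α • ((2 / affIp α α) • α)}

/-- The inversion set of `w`: the positive affine roots that `w` makes negative. -/
def affInv (b : (rootSystem H).Base) (w : AffV H ≃ₗ[ℝ] AffV H) : Set (AffV H) :=
  {x | x ∈ affPos b ∧ -(w x) ∈ affPos b}

/-- `w` is the minuscule element of the affine Weyl group attached to the set of roots `I`:
its inversion set is `{δ - γ | γ ∈ I}`. -/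
def IsMinuscule (b : (rootSystem H).Base) (θ : H.root) (I : Set H.root)
    (w : AffV H ≃ₗ[ℝ] AffV H) : Prop :=
  w ∈ affWeyl b θ ∧ affInv b w = (fun γ => delta H - emb γ) '' I

/-! ### Abelian ideals of the Borel subalgebra and their normalisers -/

/-- The Borel subalgebra: the Cartan subalgebra plus the root spaces of the positive roots. -/
def borel (b : (rootSystem H).Base) : Submodule ℂ L :=
  H.toSubmodule ⊔ ⨆ γ ∈ {γ : H.root | b.IsPos γ}, (rootSpace H γ.1).toSubmodule

/-- `𝔞` is an abelian ideal of the Borel subalgebra `𝔟`: `𝔞 ⊆ 𝔟`, `[𝔟, 𝔞] ⊆ 𝔞`,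
`[𝔞, 𝔞] = 0`. -/
def IsAbelianIdeal (b : (rootSystem H).Base) (𝔞 : LieSubalgebra ℂ L) : Prop :=
  𝔞.toSubmodule ≤ borel b ∧ (∀ x ∈ borel b, ∀ y ∈ 𝔞, ⁅x, y⁆ ∈ 𝔞) ∧
    ∀ x ∈ 𝔞, ∀ y ∈ 𝔞, ⁅x, y⁆ = 0

/-- The positive roots whose root space lies in `𝔞`. -/
def idealRoots (b : (rootSystem H).Base) (𝔞 : LieSubalgebra ℂ L) : Set H.root :=
  {γ | b.IsPos γ ∧ (rootSpace H γ.1).toSubmodule ≤ 𝔞.toSubmodule}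

/-- `μ` is the rootlet of `𝔞`: `μ = w(2δ - θ)` for the minuscule element `w` of `𝔞`. -/
def HasRootlet (b : (rootSystem H).Base) (θ : H.root) (𝔞 : LieSubalgebra ℂ L)
    (μ : H.root) : Prop :=
  ∃ w : AffV H ≃ₗ[ℝ] AffV H, IsMinuscule b θ (idealRoots b 𝔞) w ∧
    w ((2 : ℝ) • delta H - emb θ) = emb μ

/-- The set of nonzero abelian ideals with rootlet `μ`, ordered by inclusion. -/
def rootletFibre (b : (rootSystem H).Base) (θ μ : H.root) : Set (LieSubalgebra ℂ L) :=
  {𝔞 | IsAbelianIdeal b 𝔞 ∧ 𝔞 ≠ ⊥ ∧ HasRootlet b θ 𝔞 μ}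

/-- `𝔞 = 𝔞(μ)_min`, the minimum of the set of nonzero abelian ideals with rootlet `μ`. -/
def IsRootMinimal (b : (rootSystem H).Base) (θ μ : H.root) (𝔞 : LieSubalgebra ℂ L) : Prop :=
  IsLeast (rootletFibre b θ μ) 𝔞

/-- The standard Levi subalgebra of a standard parabolic subalgebra `𝔭`: the Cartan subalgebra plus
the root spaces of the roots `γ` such that `𝔭` contains the root spaces of both `γ` and `-γ`. -/
def standardLevi (𝔭 : LieSubalgebra ℂ L) : Submodule ℂ L :=
  H.toSubmodule ⊔ ⨆ γ ∈ {γ : H.root | (rootSpace H γ.1).toSubmodule ≤ 𝔭.toSubmodule ∧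
    (rootSpace H (-γ.1)).toSubmodule ≤ 𝔭.toSubmodule}, (rootSpace H γ.1).toSubmodule

/-- The simple roots of the standard Levi subalgebra of the normaliser of `𝔞`. -/
def leviSimple (b : (rootSystem H).Base) (𝔞 : LieSubalgebra ℂ L) : Set H.root :=
  {α | α ∈ b.support ∧
    (rootSpace H α.1).toSubmodule ≤ standardLevi (H := H) 𝔞.normalizer}

/-- The set `{w⁻¹(β) | β simple, (β, μ) = 0}`. -/
def transported (b : (rootSystem H).Base) (w : (rootSystem H).weylGroup) (μ : H.root) :
    Set H.root :=
  {γ | ∃ β ∈ b.support, rootIp β μ = 0 ∧ γ = act w⁻¹ β}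

end AbelianIdealNormaliser

end

/-!
Write `s_θ`, `s₀` for the reflections in the highest root `θ` and in the affine simple root
`α₀ = δ - θ`, and `v` for the element of minimal length of the finite Weyl group that takes `θ` to
`μ`. The long positive root `μ` is conjugate to `θ`, since reflecting it in simple roots raises it
until it is dominant, and a long dominant root is the highest one (`exists_act_eq`). By the exchange
condition `v` is the only element that takes `θ` to `μ` and keeps the positive roots orthogonal to
`θ` positive (`IsMinimalTo.isMinRep`, `IsMinRep.unique`).

The least ideal with rootlet `μ` is the one whose minuscule element is `v s₀`. Its roots are `θ` and
the `θ - ν`, for `ν` an inversion of `v` (`minRoots`). They form an upper set of positive roots, no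
two of which add up to a root, so they do span an abelian ideal (`exists_isAbelianIdeal`), and
`v s₀` is minuscule for it with rootlet `μ` (`exists_isMinuscule_minRoots`). Conversely, let `w` be
the minuscule element of any ideal with rootlet `μ`. If the ideal has a root `γ` orthogonal to `θ`,
take one of least height; then `-w (δ - γ)` is a simple affine root (`exists_affIdx_eq`), and
multiplying `w` on the left by the reflection in it removes `γ` and keeps the rootlet. Once no such
root is left, `w s₀` has only finite inversions, hence is an element of the finite Weyl group
(`exists_weyl_eq`); it takes `θ` to `μ` and keeps the positive roots orthogonal to `θ` positive, so
it is `v`, and the roots of `minRoots` have never been removed (`minRoots_subset`).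

As brackets of root spaces do not vanish when the sum of the roots is a root (`lie_ne_zero`), a
simple root `α` belongs to the Levi subalgebra of the normaliser of an ideal if and only if it is
not a root of the ideal and subtracting `α` from a root of the ideal never leads to a root outside
it (`leviSimple_eq_stabSimple`). For the least ideal this says that `v s₀` takes `α` to an affine
simple root: for `α` orthogonal to `θ` it means that `v α` is simple
(`mem_stabSimple_iff_of_orthogonal`), and for the other `α` it means that `v α = μ - θ`
(`mem_stabSimple_iff_of_not_orthogonal`). The latter never happens if `μ` is `θ` or orthogonal to
`θ`. In the remaining case it happens for exactly one simple root, namely `θ - v⁻¹ θ`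
(`exists_simple_act_eq`), and it is a simple root not orthogonal to `θ`, which determines it if
there is only one. In type C there is no remaining case, because the long roots pair evenly with all
simple coroots, whereas `θ` pairs to `1` with the coroot of `θ - v⁻¹ θ` (`not_hasCartanMatrix_C`).
In type A, for `μ = α₁ + ⋯ + α_i`, the element `v` is the cycle `s_{i+1} ⋯ s_n`, whose action on the
simple roots can be read off from its action on the partial sums `α₁ + ⋯ + α_j`
(`IsChain.exists_cycle`); the other family of roots `μ` follows by reversing the numbering.
-/

noncomputable section

namespace AbelianIdealNormaliser

open LieAlgebra LieAlgebra.IsKilling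

set_option linter.unusedSectionVars false

-- The vector of a root, and the integer `⟨γ, ν^∨⟩` of two roots `γ`, `ν`.
local notation "rt" => RootPairing.root (rootSystem _)
local notation "pr" => RootPairing.pairingIn (rootSystem _) ℤ

/-! ### The exchange condition -/

section Exchange

variable {ι G E : Type*} [Group G] [AddGroup E] [DistribMulAction G E]

/-- The elements `r i` of `G`, for `i` in `S`, act on `E` as reflections in the vectors `a i` that
are simple with respect to the set `P` of positive vectors: `r i` negates `a i` and permutes the
other elements of `P`. This is all that the exchange condition needs, and it holds for the finite
as well as for the affine Weyl group. -/
structure IsSimpleSystem (S : Set ι) (r : ι → G) (a : ι → E) (P : Set E) : Prop where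
  mul_self : ∀ i ∈ S, r i * r i = 1
  smul_self : ∀ i ∈ S, r i • a i = -a i
  smul_mem : ∀ i ∈ S, ∀ x ∈ P, x ≠ a i → r i • x ∈ P
  mem : ∀ i ∈ S, a i ∈ P
  neg_notMem : ∀ x ∈ P, -x ∉ P
  conj : ∀ g ∈ Subgroup.closure (r '' S), ∀ i ∈ S, ∀ j ∈ S, g • a i = a j → g * r i = r j * g

namespace IsSimpleSystem

variable {S : Set ι} {r : ι → G} {a : ι → E} {P : Set E}

lemma prod_mem_closure {l : List ι} (hl : ∀ i ∈ l, i ∈ S) :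
    (l.map r).prod ∈ Subgroup.closure (r '' S) := by
  refine Subgroup.list_prod_mem _ fun x hx => ?_
  obtain ⟨i, hi, rfl⟩ := List.mem_map.1 hx
  exact Subgroup.subset_closure ⟨i, hl i hi, rfl⟩

lemma mem_or_neg_mem (h : IsSimpleSystem S r a P) {l : List ι} (hl : ∀ i ∈ l, i ∈ S)
    {x : E} (hx : x ∈ P) : (l.map r).prod • x ∈ P ∨ -((l.map r).prod • x) ∈ P := by
  induction l with
  | nil => simpa using Or.inl hx
  | cons j l ih =>
    have hj : j ∈ S := hl j (by simp)
    simp only [List.map_cons, List.prod_cons, mul_smul]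
    rcases ih (fun i hi => hl i (by simp [hi])) with h1 | h1
    · by_cases he : (l.map r).prod • x = a j
      · right
        rw [he, h.smul_self j hj, neg_neg]
        exact h.mem j hj
      · exact .inl (h.smul_mem j hj _ h1 he)
    · rw [← smul_neg]
      by_cases he : -((l.map r).prod • x) = a j
      · left
        rw [← neg_neg ((l.map r).prod • x), he, smul_neg, h.smul_self j hj, neg_neg]
        exact h.mem j hj
      · exact .inr (h.smul_mem j hj _ h1 he)

/-- The exchange condition: a word that makes a simple vector `a i` negative can be multiplied by
`r i` by deleting one of its letters. -/
theorem exchange (h : IsSimpleSystem S r a P) {l : List ι} (hl : ∀ i ∈ l, i ∈ S) {i : ι}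
    (hi : i ∈ S) (hn : -((l.map r).prod • a i) ∈ P) :
    ∃ l' : List ι, (∀ j ∈ l', j ∈ S) ∧ l'.length + 1 = l.length ∧
      (l'.map r).prod = (l.map r).prod * r i := by
  induction l with
  | nil => exact absurd (by simpa using hn) (h.neg_notMem _ (h.mem i hi))
  | cons j l ih =>
    have hj : j ∈ S := hl j (by simp)
    have hl' : ∀ i ∈ l, i ∈ S := fun i hi => hl i (by simp [hi])
    simp only [List.map_cons, List.prod_cons, mul_smul] at hn ⊢
    rcases h.mem_or_neg_mem hl' (h.mem i hi) with h1 | h1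
    · have he : (l.map r).prod • a i = a j := by
        by_contra he
        exact h.neg_notMem _ (h.smul_mem j hj _ h1 he) hn
      refine ⟨l, hl', by simp, ?_⟩
      have := h.conj _ (prod_mem_closure hl') i hi j hj he
      rw [← this, mul_assoc, h.mul_self i hi, mul_one]
    · obtain ⟨l', h2, h3, h4⟩ := ih hl' h1
      refine ⟨j :: l', by simpa [hj] using h2, by simp [h3], by simp [h4, mul_assoc]⟩

/-- Every product of simple reflections is reached from `1` by going down along descents. -/
theorem descent_induction (h : IsSimpleSystem S r a P) {Q : G → Prop} (one : Q 1)
    (step : ∀ l : List ι, (∀ i ∈ l, i ∈ S) → ∀ i ∈ S, -((l.map r).prod • a i) ∈ P →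
      Q ((l.map r).prod * r i) → Q (l.map r).prod)
    (l : List ι) (hl : ∀ i ∈ l, i ∈ S) : Q (l.map r).prod := by
  induction hn : l.length using Nat.strong_induction_on generalizing l with
  | _ n ih =>
    by_cases hd : ∃ i ∈ S, -((l.map r).prod • a i) ∈ P
    · obtain ⟨i, hi, hd⟩ := hd
      obtain ⟨l', h1, h2, h3⟩ := h.exchange hl hi hd
      exact step l hl i hi hd (h3 ▸ ih l'.length (by omega) l' h1 rfl)
    · rcases List.eq_nil_or_concat' l with rfl | ⟨l₀, i, rfl⟩
      · simpa using one
      · -- Without descents the word is not reduced: its last letter `i` is a descent of the rest.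
        have hi : i ∈ S := hl i (by simp)
        have hl₀ : ∀ j ∈ l₀, j ∈ S := fun j hj => hl j (by simp [hj])
        have hg : ((l₀ ++ [i]).map r).prod = (l₀.map r).prod * r i := by simp
        have h1 : -((l₀.map r).prod • a i) ∈ P := by
          push Not at hd
          have h2 := (h.mem_or_neg_mem hl (h.mem i hi)).resolve_right (hd i hi)
          rwa [hg, mul_smul, h.smul_self i hi, smul_neg] at h2
        obtain ⟨l', h3, h4, h5⟩ := h.exchange hl₀ hi h1
        rw [hg, ← h5]
        exact ih l'.length (by simp at hn; omega) l' h3 rfl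

lemma exists_descent (h : IsSimpleSystem S r a P) {l : List ι} (hl : ∀ i ∈ l, i ∈ S)
    (h1 : (l.map r).prod ≠ 1) : ∃ i ∈ S, -((l.map r).prod • a i) ∈ P := by
  have := h.descent_induction (Q := fun g => g ≠ 1 → ∃ i ∈ S, -(g • a i) ∈ P)
    (fun h => absurd rfl h) (fun l hl i hi hd _ _ => ⟨i, hi, hd⟩) l hl
  exact this h1

lemma exists_word (h : IsSimpleSystem S r a P) {g : G} (hg : g ∈ Subgroup.closure (r '' S)) :
    ∃ l : List ι, (∀ i ∈ l, i ∈ S) ∧ (l.map r).prod = g := by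
  induction hg using Subgroup.closure_induction'' with
  | one => exact ⟨[], by simp, by simp⟩
  | mem x hx =>
    obtain ⟨i, hi, rfl⟩ := hx
    exact ⟨[i], by simpa using hi, by simp⟩
  | inv_mem x hx =>
    obtain ⟨i, hi, rfl⟩ := hx
    exact ⟨[i], by simpa using hi,
      by simpa using (inv_eq_of_mul_eq_one_left (h.mul_self i hi)).symm⟩
  | mul x y _ _ hx hy =>
    obtain ⟨l, h1, rfl⟩ := hx
    obtain ⟨l', h2, rfl⟩ := hy
    exact ⟨l ++ l', by simp only [List.mem_append]; rintro i (hi | hi); exacts [h1 i hi, h2 i hi],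
      by simp⟩

end IsSimpleSystem

end Exchange

/-! ### Roots, heights and inner products -/

variable {L : Type*} [LieRing L] [LieAlgebra ℂ L] [FiniteDimensional ℂ L] [IsKilling ℂ L]
  {H : LieSubalgebra ℂ L} [H.IsCartanSubalgebra]

/-- The reflection of the root `γ` in the root `α`. -/
def sr (α γ : H.root) : H.root := (rootSystem H).reflectionPerm α γ

@[simp] lemma sr_sr (α γ : H.root) : sr α (sr α γ) = γ := by
  simp [sr]

/-- The negative of a root, as a root. -/
instance instNegRoot : InvolutiveNeg H.root where
  neg γ := sr γ γ
  neg_neg := (rootSystem H).indexNeg.neg_neg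

lemma sr_self (α : H.root) : sr α α = -α := rfl

@[simp] lemma root_neg (γ : H.root) : rt (-γ) = -rt γ := by
  rw [← sr_self, sr, RootPairing.root_reflectionPerm, RootPairing.reflection_apply_self]

@[simp] lemma pr_neg_left (γ ν : H.root) : pr (-γ) ν = -pr γ ν :=
  RootPairing.pairingIn_reflectionPerm_self_left _ _ _ _

lemma root_sr (α γ : H.root) : rt (sr α γ) = rt γ - pr γ α • rt α := by
  rw [sr, RootPairing.root_reflectionPerm, RootPairing.reflection_apply_root' ℤ]

lemma root_inj {γ ν : H.root} : rt γ = rt ν ↔ γ = ν := (rootSystem H).root.injective.eq_iff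

lemma sr_of_pr_eq_zero {α γ : H.root} (h : pr γ α = 0) : sr α γ = γ := by
  rw [← root_inj, root_sr, h, zero_smul, sub_zero]

lemma rootForm_eq (x y : H.root) :
    (rootSystem H).RootForm (rt x) (rt y) = ((rootIp x y : ℝ) : ℂ) :=
  ((rootSystem H).algebraMap_rootFormIn ℝ (rootVec x) (rootVec y)).symm

lemma two_mul_rootIp (γ ν : H.root) : 2 * rootIp γ ν = pr γ ν * rootIp ν ν := by
  have h := (rootSystem H).toInvariantForm.two_mul_apply_root_root γ ν
  rw [RootPairing.toInvariantForm_form, rootForm_eq, rootForm_eq,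
    ← RootPairing.algebraMap_pairingIn _ ℤ, eq_intCast] at h
  exact_mod_cast h

lemma rootIp_comm (γ ν : H.root) : rootIp γ ν = rootIp ν γ :=
  ((rootSystem H).rootFormIn_isSymm ℝ).eq _ _ |>.symm

lemma rootIp_self_pos (γ : H.root) : 0 < rootIp γ γ := by
  have h := (rootSystem H).posRootForm_rootFormIn_posDef ℝ (rootVec γ) (by
    intro h
    exact (rootSystem H).ne_zero γ (congrArg Subtype.val h))
  exact lt_of_lt_of_eq h rfl

lemma rootIp_eq_zero {γ ν : H.root} : rootIp γ ν = 0 ↔ pr γ ν = 0 := by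
  have h := two_mul_rootIp γ ν
  have h2 := rootIp_self_pos ν
  constructor
  · intro h3
    rw [h3, mul_zero] at h
    exact_mod_cast (mul_eq_zero.1 h.symm).resolve_right h2.ne'
  · intro h3
    rw [h3] at h
    simpa using h

lemma rootIp_pos {γ ν : H.root} : 0 < rootIp γ ν ↔ 0 < pr γ ν := by
  have h := two_mul_rootIp γ ν
  have h2 := rootIp_self_pos ν
  rw [← @Int.cast_pos ℝ]
  constructor
  · intro h3
    exact pos_of_mul_pos_left (by linarith) h2.le
  · intro h3
    have := mul_pos h3 h2
    linarith

lemma pr_eq_zero_comm {γ ν : H.root} : pr γ ν = 0 ↔ pr ν γ = 0 := by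
  rw [← rootIp_eq_zero, rootIp_comm, rootIp_eq_zero]

lemma pr_pos_comm {γ ν : H.root} : 0 < pr γ ν ↔ 0 < pr ν γ := by
  rw [← rootIp_pos, rootIp_comm, rootIp_pos]

@[simp] lemma pr_self (γ : H.root) : pr γ γ = 2 := RootPairing.pairingIn_same _ _ _

@[simp] lemma pr_neg_right (γ ν : H.root) : pr γ (-ν) = -pr γ ν :=
  RootPairing.pairingIn_reflectionPerm_self_right _ _ _ _

lemma pr_neg_comm {γ ν : H.root} : pr γ ν < 0 ↔ pr ν γ < 0 := by
  simpa using (pr_pos_comm (γ := -γ) (ν := ν))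

lemma pr_add {γ ν κ : H.root} (h : rt κ = rt γ + rt ν) (α : H.root) :
    pr κ α = pr γ α + pr ν α := RootPairing.pairingIn_eq_add_of_root_eq_add h

lemma pr_sub {γ ν κ : H.root} (h : rt κ = rt γ - rt ν) (α : H.root) :
    pr κ α = pr γ α - pr ν α := by
  rw [pr_add (γ := γ) (ν := -ν) (by rw [h, root_neg, sub_eq_add_neg]), pr_neg_left]; ring

lemma exists_root_sub {γ ν : H.root} (h : 0 < pr γ ν) (hne : γ ≠ ν) :
    ∃ κ : H.root, rt κ = rt γ - rt ν :=
  (rootSystem H).root_sub_root_mem_of_pairingIn_pos h hne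

lemma exists_root_add {γ ν : H.root} (h : pr γ ν < 0) (hne : γ ≠ -ν) :
    ∃ κ : H.root, rt κ = rt γ + rt ν := by
  obtain ⟨κ, hκ⟩ := exists_root_sub (γ := γ) (ν := -ν) (by simpa using h) hne
  exact ⟨κ, by rw [hκ, root_neg, sub_neg_eq_add]⟩

variable {b : (rootSystem H).Base} {θ μ : H.root}

lemma height_neg (γ : H.root) : b.height (-γ) = -b.height γ := b.height_reflectionPerm_self γ

lemma isPos_neg {γ : H.root} : b.IsPos (-γ) ↔ ¬ b.IsPos γ := RootPairing.Base.IsPos.neg_iff_not b γ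

lemma height_pos {γ : H.root} : 0 < b.height γ ↔ b.IsPos γ := Iff.rfl

lemma height_sr (α γ : H.root) : b.height (sr α γ) = b.height γ - pr γ α * b.height α := by
  have := b.height_add_zsmul (i := γ) (j := α) (k := sr α γ) (z := -pr γ α)
    (by rw [root_sr, neg_smul, sub_eq_add_neg])
  rw [this, smul_eq_mul]; ring

/-- The height, extended to a linear functional. -/
def htLin (b : (rootSystem H).Base) : Module.Dual ℂ H →ₗ[ℂ] ℂ :=
  b.toWeightBasis.constr ℂ fun _ => (1 : ℂ)

lemma htLin_simple {α : H.root} (hα : α ∈ b.support) : htLin b (rt α) = 1 := by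
  have := b.toWeightBasis.constr_basis ℂ (fun _ => (1 : ℂ)) ⟨α, hα⟩
  rwa [RootPairing.Base.toWeightBasis_apply] at this

lemma htLin_root (γ : H.root) : htLin b (rt γ) = b.height γ := by
  obtain ⟨f, -, -, hf⟩ := b.exists_root_eq_sum_int γ
  rw [RootPairing.Base.height_eq_sum hf, hf, map_sum]
  push_cast
  refine Finset.sum_congr rfl fun i hi => ?_
  rw [map_zsmul, htLin_simple hi]; simp

lemma htLin_of_mem_closure {x : Module.Dual ℂ H}
    (hx : x ∈ AddSubmonoid.closure ((rootSystem H).root '' (b.support : Set H.root))) :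
    ∃ n : ℕ, htLin b x = n ∧ (n = 0 → x = 0) := by
  induction hx using AddSubmonoid.closure_induction with
  | mem x hx =>
    obtain ⟨α, hα, rfl⟩ := hx
    exact ⟨1, by simpa using htLin_simple hα, by simp⟩
  | zero => exact ⟨0, by simp, fun _ => rfl⟩
  | add x y _ _ hx hy =>
    obtain ⟨n, h1, h2⟩ := hx
    obtain ⟨m, h3, h4⟩ := hy
    refine ⟨n + m, by simp [h1, h3], fun h => ?_⟩
    rw [h2 (by omega), h4 (by omega), add_zero]

lemma IsHighestRoot.height_lt (hθ : IsHighestRoot b θ) {γ : H.root} (hne : γ ≠ θ) :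
    b.height γ < b.height θ := by
  by_cases hγ : b.IsPos γ
  · obtain ⟨n, h1, h2⟩ := htLin_of_mem_closure (hθ.2 γ hγ)
    rw [map_sub, htLin_root, htLin_root] at h1
    have h3 : b.height θ - b.height γ = n := by exact_mod_cast h1
    have h4 : n ≠ 0 := fun h0 => hne (root_inj.1 (sub_eq_zero.1 (h2 h0)).symm)
    omega
  · have h1 := height_pos.2 hθ.1
    have h2 : ¬ 0 < b.height γ := hγ
    omega

lemma IsHighestRoot.eq_of_height_le (hθ : IsHighestRoot b θ) {γ : H.root}
    (h : b.height θ ≤ b.height γ) : γ = θ := by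
  by_contra hne
  exact absurd (hθ.height_lt hne) (not_lt.2 h)

lemma pr_nonneg_of_forall_simple {ν γ : H.root} (h : ∀ α ∈ b.support, 0 ≤ pr ν α)
    (hγ : b.IsPos γ) : 0 ≤ pr γ ν := by
  refine hγ.induction_on_add (p := fun γ => 0 ≤ pr γ ν) (fun α hα => ?_)
    fun i j k hk hi hj => ?_
  · have := h α hα
    by_contra h2
    have := pr_neg_comm.1 (not_le.1 h2)
    omega
  · rw [pr_add hk]
    have := h j hj
    by_contra h2
    have h3 : pr j ν < 0 := by omega
    have := pr_neg_comm.1 h3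
    omega

/-- The highest root is dominant. -/
lemma IsHighestRoot.pr_nonneg (hθ : IsHighestRoot b θ) {γ : H.root} (hγ : b.IsPos γ) :
    0 ≤ pr γ θ := by
  refine pr_nonneg_of_forall_simple (fun α hα => ?_) hγ
  by_contra h
  have h1 := height_sr (b := b) α θ
  rw [RootPairing.Base.height_one_of_mem_support hα] at h1
  have h2 := hθ.eq_of_height_le (γ := sr α θ) (by omega)
  rw [h2] at h1
  omega

/-- `θ` is the only root that pairs to at least `2` with the coroot of `θ`: for any other such root
`γ`, the height of `-s_θ γ` would exceed that of `θ`. -/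
lemma IsHighestRoot.eq_of_two_le (hθ : IsHighestRoot b θ) {γ : H.root} (h : 2 ≤ pr γ θ) :
    γ = θ := by
  by_contra hne
  have h1 := hθ.height_lt hne
  have h2 := height_sr (b := b) θ γ
  have h3 : b.height (-(sr θ γ)) ≤ b.height θ := by
    by_cases h4 : -(sr θ γ) = θ
    · rw [h4]
    · exact (hθ.height_lt h4).le
  rw [height_neg] at h3
  have h5 := height_pos.2 hθ.1
  nlinarith

lemma IsHighestRoot.isPos_of_pr_pos (hθ : IsHighestRoot b θ) {γ : H.root} (h : 0 < pr γ θ) :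
    b.IsPos γ := by
  by_contra h1
  have := hθ.pr_nonneg (isPos_neg.2 h1)
  rw [pr_neg_left] at this
  omega

lemma IsHighestRoot.pr_le_one (hθ : IsHighestRoot b θ) {γ : H.root} (hne : γ ≠ θ) :
    pr γ θ ≤ 1 := by
  by_contra h
  exact hne (hθ.eq_of_two_le (by omega))

/-- A positive root that is not simple is the sum of a positive root and a simple root. -/
lemma exists_eq_add_of_notMem_support {γ : H.root} (hγ : b.IsPos γ) (hs : γ ∉ b.support) :
    ∃ ν α : H.root, b.IsPos ν ∧ α ∈ b.support ∧ rt γ = rt ν + rt α := by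
  obtain ⟨α, hα, h⟩ := hγ.exists_mem_support_pos_pairingIn
  have hne : γ ≠ α := fun h => hs (h ▸ hα)
  obtain ⟨ν, hν⟩ := exists_root_sub (pr_pos_comm.1 h) hne
  exact ⟨ν, α, hγ.sub hα hν, hα, by rw [hν, sub_add_cancel]⟩

/-- A simple root is not the sum of two positive roots. -/
lemma notMem_support_of_eq_add {γ ν κ : H.root} (hν : b.IsPos ν) (hκ : b.IsPos κ)
    (h : rt γ = rt ν + rt κ) : γ ∉ b.support := by
  intro hs
  have h1 := b.height_add h
  have h2 := height_pos.2 hν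
  have h3 := height_pos.2 hκ
  rw [RootPairing.Base.height_one_of_mem_support hs] at h1
  omega

/-! ### The Weyl group and minimal elements -/

variable (H) in
/-- The Weyl group of the root system of `H`. -/
abbrev Weyl : Type _ := (rootSystem H).weylGroup

variable {v : Weyl H}

lemma root_act (w : Weyl H) (γ : H.root) : rt (act w γ) = w • rt γ :=
  ((rootSystem H).weylGroup_apply_root w γ).symm

@[simp] lemma act_one (γ : H.root) : act 1 γ = γ := by simp [act]

lemma act_mul (w w' : Weyl H) (γ : H.root) : act (w * w') γ = act w (act w' γ) := by simp [act]

@[simp] lemma act_inv_act (w : Weyl H) (γ : H.root) : act w⁻¹ (act w γ) = γ := by simp [← act_mul]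

@[simp] lemma act_act_inv (w : Weyl H) (γ : H.root) : act w (act w⁻¹ γ) = γ := by simp [← act_mul]

lemma act_injective (w : Weyl H) : Function.Injective (act w) :=
  Function.LeftInverse.injective (act_inv_act w)

lemma act_ofIdx (α γ : H.root) :
    act (RootPairing.weylGroup.ofIdx (rootSystem H) α) γ = sr α γ := by
  rw [← root_inj, root_act, sr, RootPairing.root_reflectionPerm]; rfl

@[simp] lemma act_neg (w : Weyl H) (γ : H.root) : act w (-γ) = -act w γ := by
  rw [← root_inj, root_act, root_neg, root_neg, smul_neg, root_act]

lemma act_add (w : Weyl H) {γ ν κ : H.root} (h : rt κ = rt γ + rt ν) :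
    rt (act w κ) = rt (act w γ) + rt (act w ν) := by
  rw [root_act, h, smul_add, root_act, root_act]

lemma act_sub (w : Weyl H) {γ ν κ : H.root} (h : rt κ = rt γ - rt ν) :
    rt (act w κ) = rt (act w γ) - rt (act w ν) := by
  rw [root_act, h, smul_sub, root_act, root_act]

@[simp] lemma rootIp_act (w : Weyl H) (γ ν : H.root) : rootIp (act w γ) (act w ν) = rootIp γ ν := by
  have h := RootPairing.InvariantForm.apply_weylGroup_smul (rootSystem H)
    (B := (rootSystem H).toInvariantForm) w (rt γ) (rt ν)
  rw [RootPairing.toInvariantForm_form, ← root_act, ← root_act, rootForm_eq, rootForm_eq] at h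
  exact_mod_cast h

@[simp] lemma pr_act (w : Weyl H) (γ ν : H.root) : pr (act w γ) (act w ν) = pr γ ν := by
  have h1 := two_mul_rootIp γ ν
  have h2 := two_mul_rootIp (act w γ) (act w ν)
  rw [rootIp_act, rootIp_act, h1] at h2
  exact_mod_cast (mul_right_cancel₀ (rootIp_self_pos ν).ne' h2).symm

lemma act_sr (w : Weyl H) (α γ : H.root) : act w (sr α γ) = sr (act w α) (act w γ) := by
  rw [← root_inj, root_act, root_sr, root_sr, pr_act, smul_sub, root_act, root_act,
    smul_comm]

lemma weylGroup_ext {w w' : Weyl H} (h : ∀ γ : H.root, act w γ = act w' γ) : w = w' := by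
  apply Subtype.ext
  apply RootPairing.Equiv.weightHom_injective
  apply LinearEquiv.toLinearMap_injective
  refine LinearMap.ext_on_range (v := (rootSystem H).root)
    RootPairing.IsRootSystem.span_root_eq_top fun γ => ?_
  have := congrArg (rootSystem H).root (h γ)
  rwa [root_act, root_act] at this

lemma mul_ofIdx {w : Weyl H} {α β : H.root} (h : act w α = β) :
    w * RootPairing.weylGroup.ofIdx (rootSystem H) α =
      RootPairing.weylGroup.ofIdx (rootSystem H) β * w :=
  weylGroup_ext fun γ => by rw [act_mul, act_mul, act_ofIdx, act_ofIdx, act_sr, h]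

lemma isPos_sr {α γ : H.root} (hα : α ∈ b.support) (hγ : b.IsPos γ) (hne : γ ≠ α) :
    b.IsPos (sr α γ) := hγ.reflectionPerm hα hne

/-- The vectors of the positive roots. -/
def posVecs (b : (rootSystem H).Base) : Set (Module.Dual ℂ H) := {x | ∃ γ, b.IsPos γ ∧ rt γ = x}

@[simp] lemma root_mem_posVecs {γ : H.root} : rt γ ∈ posVecs b ↔ b.IsPos γ :=
  ⟨fun ⟨_, h, h'⟩ => root_inj.1 h' ▸ h, fun h => ⟨γ, h, rfl⟩⟩

/-- The simple reflections, with the simple roots as vectors, satisfy the axioms of a simple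
system. -/
lemma isSimpleSystem (b : (rootSystem H).Base) :
    IsSimpleSystem (b.support : Set H.root) (RootPairing.weylGroup.ofIdx (rootSystem H))
      (rootSystem H).root (posVecs b) where
  mul_self α _ := weylGroup_ext fun γ => by rw [act_mul, act_ofIdx, act_ofIdx, sr_sr, act_one]
  smul_self α _ := by rw [← root_act, act_ofIdx, sr_self, root_neg]
  smul_mem α hα := by
    rintro _ ⟨γ, hγ, rfl⟩ hne
    rw [← root_act, act_ofIdx, root_mem_posVecs]
    exact isPos_sr hα hγ fun h => hne (by rw [h])
  mem α hα := root_mem_posVecs.2 (RootPairing.Base.isPos_of_mem_support hα)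
  neg_notMem := by
    rintro _ ⟨γ, hγ, rfl⟩ h
    rw [← root_neg, root_mem_posVecs, isPos_neg] at h
    exact h hγ
  conj g _ α _ β _ h := mul_ofIdx (root_inj.1 (by rw [root_act, h]))

lemma ofIdx_sr (α γ : H.root) : RootPairing.weylGroup.ofIdx (rootSystem H) (sr α γ) =
    RootPairing.weylGroup.ofIdx (rootSystem H) α * RootPairing.weylGroup.ofIdx (rootSystem H) γ *
      RootPairing.weylGroup.ofIdx (rootSystem H) α := by
  rw [mul_ofIdx (act_ofIdx α γ), mul_assoc]
  refine weylGroup_ext fun ν => ?_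
  simp [act_mul, act_ofIdx]

/-- The Weyl group is generated by the simple reflections. -/
lemma mem_closure_simple (b : (rootSystem H).Base) (w : Weyl H) : w ∈ Subgroup.closure
    (RootPairing.weylGroup.ofIdx (rootSystem H) '' (b.support : Set H.root)) := by
  set C := Subgroup.closure
    (RootPairing.weylGroup.ofIdx (rootSystem H) '' (b.support : Set H.root))
  have hs : ∀ α ∈ b.support, RootPairing.weylGroup.ofIdx (rootSystem H) α ∈ C :=
    fun α hα => Subgroup.subset_closure ⟨α, hα, rfl⟩
  have key : ∀ γ : H.root, RootPairing.weylGroup.ofIdx (rootSystem H) γ ∈ C := by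
    intro γ
    refine b.induction_reflect γ (fun i hi => ?_) hs fun i j hi hj => ?_
    · change RootPairing.weylGroup.ofIdx (rootSystem H) (sr i i) ∈ C
      rw [ofIdx_sr]
      exact mul_mem (mul_mem hi hi) hi
    · change RootPairing.weylGroup.ofIdx (rootSystem H) (sr j i) ∈ C
      rw [ofIdx_sr]
      exact mul_mem (mul_mem (hs j hj) hi) (hs j hj)
  obtain ⟨g, hg⟩ := w
  induction hg using RootPairing.weylGroup.induction with
  | mem i => exact key i
  | one => exact one_mem C
  | mul x y hx hy h1 h2 => exact mul_mem h1 h2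

lemma exists_simple_word (b : (rootSystem H).Base) (w : Weyl H) : ∃ l : List H.root,
    (∀ α ∈ l, α ∈ b.support) ∧ (l.map (RootPairing.weylGroup.ofIdx (rootSystem H))).prod = w :=
  (isSimpleSystem b).exists_word (mem_closure_simple b w)

lemma length_le {w : Weyl H} {l : List H.root} (hl : ∀ α ∈ l, α ∈ b.support)
    (h : (l.map (RootPairing.weylGroup.ofIdx (rootSystem H))).prod = w) :
    length b w ≤ l.length :=
  Nat.sInf_le ⟨l, hl, rfl, h⟩

lemma exists_reduced_word (b : (rootSystem H).Base) (w : Weyl H) : ∃ l : List H.root,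
    (∀ α ∈ l, α ∈ b.support) ∧ l.length = length b w ∧
      (l.map (RootPairing.weylGroup.ofIdx (rootSystem H))).prod = w := by
  obtain ⟨l, hl, h⟩ := exists_simple_word b w
  exact Nat.sInf_mem (s := {n : ℕ | ∃ l : List H.root, (∀ α ∈ l, α ∈ b.support) ∧ l.length = n ∧
    (l.map (RootPairing.weylGroup.ofIdx (rootSystem H))).prod = w}) ⟨_, l, hl, rfl, h⟩

/-- Only the identity keeps all simple roots positive. -/
lemma exists_simple_neg {w : Weyl H} (h : w ≠ 1) : ∃ α ∈ b.support, ¬ b.IsPos (act w α) := by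
  obtain ⟨l, hl, rfl⟩ := exists_simple_word b w
  obtain ⟨α, hα, h1⟩ := (isSimpleSystem b).exists_descent hl h
  rw [← root_act, ← root_neg, root_mem_posVecs, isPos_neg] at h1
  exact ⟨α, hα, h1⟩

/-- `w` takes `θ` to `μ` and keeps the positive roots orthogonal to `θ` positive: this describes
the element of minimal length among those taking `θ` to `μ`. -/
structure IsMinRep (b : (rootSystem H).Base) (θ μ : H.root) (w : Weyl H) : Prop where
  act_eq : act w θ = μ
  isPos : ∀ γ : H.root, b.IsPos γ → pr γ θ = 0 → b.IsPos (act w γ)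

/-- A positive root orthogonal to the dominant root `θ` is a sum of simple roots orthogonal to `θ`,
so that positivity has to be checked on these only. -/
lemma isPos_of_forall_simple_orthogonal (hθ : IsHighestRoot b θ) {w : Weyl H}
    (h : ∀ α ∈ b.support, pr α θ = 0 → b.IsPos (act w α)) {γ : H.root} (hγ : b.IsPos γ)
    (h0 : pr γ θ = 0) : b.IsPos (act w γ) := by
  suffices b.IsPos γ ∧ (pr γ θ = 0 → b.IsPos (act w γ)) from this.2 h0
  refine hγ.induction_on_add (p := fun γ => b.IsPos γ ∧ (pr γ θ = 0 → b.IsPos (act w γ)))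
    (fun α hα => ⟨RootPairing.Base.isPos_of_mem_support hα, h α hα⟩) ?_
  intro i j k hk ⟨hi, hi'⟩ hj
  have hj' := RootPairing.Base.isPos_of_mem_support hj
  refine ⟨hi.add hj' hk, fun h1 => ?_⟩
  rw [pr_add hk] at h1
  have h2 := hθ.pr_nonneg hi
  have h3 := hθ.pr_nonneg hj'
  exact (hi' (by omega)).add (h j hj (by omega)) (act_add w hk)

/-- If a minimal `w` made a simple root `α ⊥ θ` negative, the shorter `w s_α` would take `θ` to the
same root. -/
lemma IsMinimalTo.isMinRep (hθ : IsHighestRoot b θ) {w : Weyl H} (hw : IsMinimalTo b θ μ w) :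
    IsMinRep b θ μ w := by
  refine ⟨hw.1, fun γ => isPos_of_forall_simple_orthogonal hθ fun α hα h0 => ?_⟩
  by_contra hn
  obtain ⟨l, hl, hlen, h1⟩ := exists_reduced_word b w
  obtain ⟨l', hl', hlen', h2⟩ := (isSimpleSystem b).exchange hl hα (by
    rw [h1, ← root_act, ← root_neg, root_mem_posVecs, isPos_neg]; exact hn)
  have h3 := hw.2 (w * RootPairing.weylGroup.ofIdx (rootSystem H) α) (by
    rw [act_mul, act_ofIdx, sr_of_pr_eq_zero (pr_eq_zero_comm.1 h0), hw.1])
  have h4 := length_le hl' (h2.trans (by rw [h1]))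
  omega

lemma IsMinRep.unique (hθ : IsHighestRoot b θ) {v w : Weyl H} (hv : IsMinRep b θ μ v)
    (hw : IsMinRep b θ μ w) : v = w := by
  by_contra hne
  -- The quotient `y = v⁻¹ w` fixes `θ`, so by dominance its descents are orthogonal to `θ`.
  obtain ⟨α, hα, hn⟩ := exists_simple_neg (b := b) (w := v⁻¹ * w)
    fun h => hne (inv_mul_eq_one.1 h)
  have hy : act (v⁻¹ * w) θ = θ := by rw [act_mul, hw.act_eq, ← hv.act_eq, act_inv_act]
  have h1 := hθ.pr_nonneg (isPos_neg.2 hn)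
  have h2 := hθ.pr_nonneg (RootPairing.Base.isPos_of_mem_support hα)
  have h3 : pr (act (v⁻¹ * w) α) θ = pr α θ := by
    conv_lhs => rw [← hy]
    exact pr_act _ _ _
  rw [pr_neg_left, h3] at h1
  have h4 := hw.isPos α (RootPairing.Base.isPos_of_mem_support hα) (by omega)
  have h5 := hv.isPos _ (isPos_neg.2 hn) (by rw [pr_neg_left, h3]; omega)
  rw [act_neg, act_mul, act_act_inv, isPos_neg] at h5
  exact h5 h4

/-- As `θ - ν` is a sum of simple roots, it pairs nonnegatively with the dominant root `ν`. -/
lemma rootIp_le_of_dominant (hθ : IsHighestRoot b θ) {ν : H.root} (hν : b.IsPos ν)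
    (hd : ∀ α ∈ b.support, 0 ≤ pr ν α) : rootIp ν ν ≤ rootIp θ ν := by
  have key : ∀ x ∈ AddSubmonoid.closure ((rootSystem H).root '' (b.support : Set H.root)),
      ∃ c : ℝ, 0 ≤ c ∧ (rootSystem H).RootForm x (rt ν) = c := by
    intro x hx
    induction hx using AddSubmonoid.closure_induction with
    | mem x hx =>
      obtain ⟨α, hα, rfl⟩ := hx
      refine ⟨rootIp α ν, ?_, rootForm_eq _ _⟩
      rcases (hd α hα).eq_or_lt with h | h
      · exact (rootIp_eq_zero.2 (pr_eq_zero_comm.1 h.symm)).ge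
      · exact (rootIp_pos.2 (pr_pos_comm.1 h)).le
    | zero => exact ⟨0, le_rfl, by simp⟩
    | add x y _ _ hx hy =>
      obtain ⟨c, hc, h1⟩ := hx
      obtain ⟨d, hd, h2⟩ := hy
      exact ⟨c + d, add_nonneg hc hd, by rw [map_add, LinearMap.add_apply, h1, h2]; push_cast; rfl⟩
  obtain ⟨c, hc, h⟩ := key _ (hθ.2 ν hν)
  rw [map_sub, LinearMap.sub_apply, rootForm_eq, rootForm_eq] at h
  have : rootIp θ ν - rootIp ν ν = c := by exact_mod_cast h
  linarith

/-- A long dominant root is the highest root. -/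
lemma eq_highest_of_dominant (hθ : IsHighestRoot b θ) {ν : H.root} (hν : b.IsPos ν)
    (hl : IsLong ν) (hd : ∀ α ∈ b.support, 0 ≤ pr ν α) : ν = θ := by
  by_contra hne
  have h1 := rootIp_le_of_dominant hθ hν hd
  have h2 := hl θ
  have h3 := two_mul_rootIp ν θ
  have h4 := rootIp_self_pos θ
  have h5 : ((pr ν θ : ℤ) : ℝ) ≤ 1 := by exact_mod_cast hθ.pr_le_one hne
  rw [rootIp_comm] at h3
  nlinarith

lemma isLong_act {ν : H.root} (w : Weyl H) (h : IsLong ν) : IsLong (act w ν) := by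
  intro κ
  rw [rootIp_act]
  exact h κ

/-- Every long positive root is conjugate to the highest root: reflecting in simple roots raises
it until it is dominant. -/
lemma exists_act_eq (hθ : IsHighestRoot b θ) (hμ : b.IsPos μ) (hl : IsLong μ) :
    ∃ w : Weyl H, act w θ = μ := by
  induction hn : (b.height θ - b.height μ).toNat using Nat.strong_induction_on generalizing μ with
  | _ n ih =>
    by_cases hd : ∀ α ∈ b.support, 0 ≤ pr μ α
    · exact ⟨1, by rw [act_one, eq_highest_of_dominant hθ hμ hl hd]⟩
    · push Not at hd
      obtain ⟨α, hα, h⟩ := hd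
      have hne : μ ≠ α := by rintro rfl; simp at h
      have h1 := height_sr (b := b) α μ
      rw [RootPairing.Base.height_one_of_mem_support hα] at h1
      have h2 : b.height μ < b.height θ := hθ.height_lt (by
        rintro rfl
        have := hθ.pr_nonneg (RootPairing.Base.isPos_of_mem_support hα)
        have := pr_neg_comm.1 h
        omega)
      obtain ⟨w, hw⟩ := ih _ (by omega) (isPos_sr hα hμ hne)
        (by rw [← act_ofIdx]; exact isLong_act _ hl) rfl
      exact ⟨RootPairing.weylGroup.ofIdx _ α * w, by rw [act_mul, hw, act_ofIdx, sr_sr]⟩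

lemma existsUnique_isMinimalTo (hθ : IsHighestRoot b θ) (hμ : b.IsPos μ) (hl : IsLong μ) :
    ∃! w : Weyl H, IsMinimalTo b θ μ w := by
  obtain ⟨w, hw, hmin⟩ := WellFounded.has_min
    (InvImage.wf (length b) wellFounded_lt) {w : Weyl H | act w θ = μ} (exists_act_eq hθ hμ hl)
  have h1 : IsMinimalTo b θ μ w := ⟨hw, fun w' h' => not_lt.1 (hmin w' h')⟩
  exact ⟨w, h1, fun w' h' => (h'.isMinRep hθ).unique hθ (h1.isMinRep hθ)⟩

/-! ### The roots of the minimal ideal and their stabilising simple roots -/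

/-- The roots of `𝔞(μ)_min`, where `v` is the minimal element taking `θ` to `μ`: besides `θ`, the
roots `γ = θ - ν` where `ν` is an inversion of `v`. As `ν` pairs to `1` with the coroot of `θ`,
the condition on `ν = -s_θ γ` reads: `v (s_θ γ)` is positive. -/
def minRoots (b : (rootSystem H).Base) (θ : H.root) (v : Weyl H) : Set H.root :=
  {γ | γ = θ ∨ (pr γ θ = 1 ∧ b.IsPos (act v (sr θ γ)))}

/-- The simple roots `α` such that `-α` stabilises the set of roots `I`. When `I` is the set of
roots of an ideal `𝔞` of the Borel subalgebra, these are the simple roots of the Levi subalgebra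
of the normaliser of `𝔞`. -/
def stabSimple (b : (rootSystem H).Base) (I : Set H.root) : Set H.root :=
  {α | α ∈ b.support ∧ α ∉ I ∧ ∀ γ ∈ I, ∀ κ : H.root, rt κ = rt γ - rt α → κ ∈ I}

lemma self_mem_minRoots : θ ∈ minRoots b θ v := .inl rfl

lemma pr_sr_self (α γ : H.root) : pr (sr α γ) α = -pr γ α := by
  have := RootPairing.pairingIn_reflectionPerm (rootSystem H) ℤ α γ α
  rw [RootPairing.pairingIn_reflectionPerm_self_right] at this
  exact this.symm

lemma sr_mem_minRoots {x : H.root} (h : pr x θ = -1) (hx : b.IsPos (act v x)) :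
    sr θ x ∈ minRoots b θ v :=
  .inr ⟨by rw [pr_sr_self, h]; rfl, by rwa [sr_sr]⟩

lemma one_le_pr_of_mem_minRoots {γ : H.root} (h : γ ∈ minRoots b θ v) : 1 ≤ pr γ θ := by
  rcases h with rfl | ⟨h, -⟩
  · simp
  · exact h.ge

lemma IsHighestRoot.isPos_of_mem_minRoots (hθ : IsHighestRoot b θ) {γ : H.root}
    (h : γ ∈ minRoots b θ v) : b.IsPos γ :=
  hθ.isPos_of_pr_pos (one_le_pr_of_mem_minRoots h)

lemma isPos_add_height {γ ν κ : H.root} (h : rt κ = rt γ + rt ν) (hγ : b.IsPos γ) :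
    b.height ν < b.height κ := by
  rw [b.height_add h]
  have := height_pos.2 hγ
  omega

lemma IsHighestRoot.add_ne (hθ : IsHighestRoot b θ) {γ κ : H.root} (hγ : b.IsPos γ) :
    rt κ ≠ rt γ + rt θ := by
  intro h
  have h1 := isPos_add_height h hγ
  by_cases h2 : κ = θ
  · rw [h2] at h1; omega
  · have := hθ.height_lt h2; omega

/-- `minRoots` is an upper set. -/
lemma minRoots_add (hθ : IsHighestRoot b θ) (hv : IsMinRep b θ μ v) {γ α κ : H.root}
    (hγ : γ ∈ minRoots b θ v) (hα : b.IsPos α) (h : rt κ = rt α + rt γ) :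
    κ ∈ minRoots b θ v := by
  rcases hγ with rfl | ⟨h1, h2⟩
  · exact absurd h (hθ.add_ne hα)
  · have h3 := hθ.pr_nonneg hα
    have h4 := pr_add h θ
    by_cases h5 : κ = θ
    · exact .inl h5
    have h6 := hθ.pr_le_one h5
    have h7 : pr α θ = 0 := by omega
    refine .inr ⟨by omega, (hv.isPos α hα h7).add h2 (act_add v ?_)⟩
    rw [root_sr, root_sr, h, show pr κ θ = pr γ θ by omega]
    abel

/-- `minRoots` is abelian: two of its elements never add up to a root. -/
lemma minRoots_add_ne (hθ : IsHighestRoot b θ) (hμ : b.IsPos μ) (hv : IsMinRep b θ μ v)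
    {γ γ' κ : H.root} (hγ : γ ∈ minRoots b θ v) (hγ' : γ' ∈ minRoots b θ v) :
    rt κ ≠ rt γ + rt γ' := by
  intro h
  have h1 := one_le_pr_of_mem_minRoots hγ
  have h2 := one_le_pr_of_mem_minRoots hγ'
  have h3 := pr_add h θ
  have h4 := hθ.eq_of_two_le (γ := κ) (by omega)
  subst h4
  rcases hγ' with rfl | ⟨h5, h6⟩
  · exact hθ.add_ne (hθ.isPos_of_mem_minRoots hγ) h
  rcases hγ with rfl | ⟨h7, h8⟩
  · exact hθ.add_ne (hθ.isPos_of_pr_pos (by omega)) (h.trans (add_comm _ _))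
  -- Now `γ + γ' = θ`, and `v` makes both `γ` and `γ'` negative, but not `θ`.
  have h9 : rt (-κ) = rt (sr κ γ) + rt (sr κ γ') := by
    rw [root_sr, root_sr, h5, h7, root_neg, one_smul, h]; abel
  have := h8.add h6 (act_add v h9)
  rw [act_neg, hv.act_eq, isPos_neg] at this
  exact this hμ

lemma exists_simple_pr_neg (hθ : IsHighestRoot b θ) {η : H.root} (hη : b.IsPos η)
    (h : pr η θ = 0) : ∃ α ∈ b.support, pr η α < 0 := by
  by_contra! hd
  have h1 := rootIp_le_of_dominant hθ hη hd
  have h2 := rootIp_self_pos η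
  rw [rootIp_eq_zero.2 (pr_eq_zero_comm.1 h)] at h1
  exact absurd h1 (not_le.2 h2)

lemma ne_neg_of_isPos {γ ν : H.root} (hγ : b.IsPos γ) (hν : b.IsPos ν) : γ ≠ -ν := by
  rintro rfl
  exact isPos_neg.1 hγ hν

/-- A positive root other than `θ` can be enlarged by a positive root. -/
lemma exists_isPos_add (hθ : IsHighestRoot b θ) {η : H.root} (hη : b.IsPos η) (hne : η ≠ θ) :
    ∃ ε κ : H.root, b.IsPos ε ∧ rt κ = rt η + rt ε := by
  rcases (hθ.pr_nonneg hη).eq_or_lt with h | h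
  · obtain ⟨α, hα, h1⟩ := exists_simple_pr_neg hθ hη h.symm
    have hα' := RootPairing.Base.isPos_of_mem_support hα
    obtain ⟨κ, hκ⟩ := exists_root_add h1 (ne_neg_of_isPos hη hα')
    exact ⟨α, κ, hα', hκ⟩
  · obtain ⟨ε, hε⟩ := exists_root_sub (pr_pos_comm.1 h) hne.symm
    refine ⟨ε, θ, ?_, by rw [hε, add_sub_cancel]⟩
    have := b.height_sub hε
    have := hθ.height_lt hne
    exact height_pos.1 (by omega)

lemma root_neg_sr {γ : H.root} (h : pr γ θ = 1) : rt (-sr θ γ) = rt θ - rt γ := by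
  rw [root_neg, root_sr, h, one_smul, neg_sub]

/-- For a simple root `α` orthogonal to `θ`, the stabilising condition says that `v α` is simple:
a decomposition of `v α` into positive roots gives a root of the ideal that `-α` moves out. -/
lemma mem_stabSimple_iff_of_orthogonal (hθ : IsHighestRoot b θ) (hμ : b.IsPos μ)
    (hv : IsMinRep b θ μ v) {α : H.root} (hα : α ∈ b.support) (h0 : pr α θ = 0) :
    α ∈ stabSimple b (minRoots b θ v) ↔ act v α ∈ b.support := by
  have hα' := RootPairing.Base.isPos_of_mem_support hα
  constructor
  · rintro ⟨-, -, hst⟩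
    by_contra hs
    obtain ⟨y, β, hy, hβ, hyβ⟩ := exists_eq_add_of_notMem_support (hv.isPos α hα' h0) hs
    replace hβ := RootPairing.Base.isPos_of_mem_support hβ
    -- Both summands of `v α` come from positive roots, so that `α` is not simple either.
    have key : ∀ y₁ y₂ : H.root, b.IsPos y₁ → b.IsPos y₂ → rt (act v α) = rt y₁ + rt y₂ →
        b.IsPos (act v⁻¹ y₁) := by
      intro y₁ y₂ h1 h2 h12
      by_contra hn
      set x₁ := act v⁻¹ y₁ with hx₁
      set x₂ := act v⁻¹ y₂ with hx₂
      have e1 : act v x₁ = y₁ := act_act_inv v y₁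
      have e2 : act v x₂ = y₂ := act_act_inv v y₂
      have hsum : rt α = rt x₁ + rt x₂ := by
        have := act_add v⁻¹ h12
        rwa [act_inv_act] at this
      have h3 := pr_add hsum θ
      have h4 := hθ.pr_nonneg (isPos_neg.2 hn)
      rw [pr_neg_left] at h4
      have h5 : pr x₁ θ ≠ 0 := by
        intro h
        have := hv.isPos _ (isPos_neg.2 hn) (by rw [pr_neg_left, h]; rfl)
        rw [act_neg, e1, isPos_neg] at this
        exact this h1
      have h6 : -x₁ ≠ θ := by
        intro h
        have := hv.act_eq
        rw [← h, act_neg, e1] at this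
        rw [← this, isPos_neg] at hμ
        exact hμ h1
      have h7 := hθ.pr_le_one h6
      rw [pr_neg_left] at h7
      have h8 : pr x₁ θ = -1 := by omega
      have h9 : pr x₂ θ = 1 := by omega
      have hmem := hst _ (sr_mem_minRoots h8 (e1.symm ▸ h1)) (-sr θ x₂) (by
        rw [root_neg_sr h9, root_sr, h8, hsum, neg_smul, one_smul]; abel)
      rcases hmem with h | ⟨-, h⟩
      · have h10 : pr (-sr θ x₂) θ = 1 := by rw [pr_neg_left, pr_sr_self, h9]; rfl
        rw [h, pr_self] at h10
        omega
      · have h10 : sr θ (-sr θ x₂) = -x₂ := by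
          rw [← root_inj, root_sr, pr_neg_left, pr_sr_self, h9, root_neg, root_sr, h9, root_neg]
          simp only [neg_neg, one_smul]
          abel
        rw [h10, act_neg, e2, isPos_neg] at h
        exact h h2
    have h1 := key y β hy hβ hyβ
    have h2 := key β y hβ hy (hyβ.trans (add_comm _ _))
    have h3 := act_add v⁻¹ hyβ
    rw [act_inv_act] at h3
    exact notMem_support_of_eq_add h1 h2 h3 hα
  · intro hs
    refine ⟨hα, ?_, ?_⟩
    · intro h
      have := one_le_pr_of_mem_minRoots h
      omega
    · rintro γ (rfl | ⟨h1, h2⟩) κ hκ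
      · exfalso
        have h1 : pr κ α = -2 := by rw [pr_sub hκ, pr_eq_zero_comm.1 h0, pr_self]; rfl
        refine hθ.add_ne (κ := sr α κ) hα' ?_
        rw [root_sr, h1, hκ]
        module
      · have h3 := pr_sub hκ θ
        have h4 : pr κ θ = 1 := by omega
        refine .inr ⟨h4, h2.sub hs (act_sub v ?_)⟩
        rw [root_sr, root_sr, h1, h4, hκ]
        abel

/-- For a simple root `α` not orthogonal to `θ`, the stabilising condition says `v α = μ - θ`.
In affine terms: the minuscule element takes `α` to `δ - (μ - v α)`, and the condition says that
this is the affine simple root `δ - θ`. -/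
lemma mem_stabSimple_iff_of_not_orthogonal (hθ : IsHighestRoot b θ) (hμ : b.IsPos μ)
    (hv : IsMinRep b θ μ v) {α : H.root} (hα : α ∈ b.support) (h0 : pr α θ ≠ 0) :
    α ∈ stabSimple b (minRoots b θ v) ↔ rt (act v α) = rt μ - rt θ := by
  have hα' := RootPairing.Base.isPos_of_mem_support hα
  have h0' := hθ.pr_nonneg hα'
  constructor
  · rintro ⟨-, hni, hst⟩
    have hne : α ≠ θ := fun h => hni (.inl h)
    have h1 := hθ.pr_le_one hne
    have h2 : pr α θ = 1 := by omega
    have hη : rt (act v (-sr θ α)) = rt μ - rt (act v α) := by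
      rw [← hv.act_eq]
      exact act_sub v (root_neg_sr h2)
    have h3 : pr (-sr θ α) θ = 1 := by rw [pr_neg_left, pr_sr_self, h2]; rfl
    have hneg : ¬ b.IsPos (act v α) := by
      rcases hst θ self_mem_minRoots (-sr θ α) (root_neg_sr h2) with h | ⟨-, h⟩
      · rw [h, pr_self] at h3; omega
      · have : sr θ (-sr θ α) = -α := by
          rw [← root_inj, root_sr, h3, root_neg, root_sr, h2, root_neg]; abel
        rwa [this, act_neg, isPos_neg] at h
    have hηpos : b.IsPos (act v (-sr θ α)) := by
      refine hμ.add (isPos_neg.2 hneg) ?_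
      rw [hη, root_neg, sub_eq_add_neg]
    by_contra hc
    -- Otherwise `η = μ - v α` is not the highest root and `η + ε` is a root for some `ε > 0`.
    obtain ⟨ε, κ, hε, hκ⟩ := exists_isPos_add hθ hηpos (by
      intro h
      rw [h] at hη
      exact hc (by rw [hη]; abel))
    set x := act v⁻¹ ε with hx
    have ex : act v x = ε := act_act_inv v ε
    have hκ' : rt (act v⁻¹ κ) = rt θ - rt α + rt x := by
      have := act_add v⁻¹ hκ
      rw [act_inv_act, root_neg_sr h2] at this
      exact this
    have h4 : pr (act v⁻¹ κ) θ = 1 + pr x θ := by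
      rw [pr_add (γ := -sr θ α) (ν := x) (by rw [hκ', root_neg_sr h2]), h3]
    have h6 : pr x θ ≤ 0 := by
      by_contra h
      have h7 := hθ.eq_of_two_le (γ := act v⁻¹ κ) (by omega)
      rw [h7] at hκ'
      have h8 : x = α := root_inj.1 (by
        have : rt x - rt α = 0 := by
          rw [sub_add_eq_add_sub, add_sub_assoc] at hκ'
          exact left_eq_add.1 hκ'
        exact sub_eq_zero.1 this)
      rw [← h8, ex] at hneg
      exact hneg hε
    have h7 : -1 ≤ pr x θ := by
      by_contra h
      have h8 := hθ.eq_of_two_le (γ := -x) (by rw [pr_neg_left]; omega)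
      have h9 := hv.act_eq
      rw [← h8, act_neg, ex] at h9
      rw [← h9, isPos_neg] at hμ
      exact hμ hε
    -- With `x = v⁻¹ ε` there remain `⟨x, θ^∨⟩ = 0`, where `α` is the sum of `x` and another
    -- positive root, and `⟨x, θ^∨⟩ = -1`, where `-α` moves `s_θ x` out of the ideal.
    rcases h6.eq_or_lt with h8 | h8
    · have h9 : b.IsPos x := by
        by_contra hn
        have := hv.isPos _ (isPos_neg.2 hn) (by rw [pr_neg_left, h8]; rfl)
        rw [act_neg, ex, isPos_neg] at this
        exact this hε
      have h10 : pr (act v⁻¹ κ) θ = 1 := by omega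
      have h11 : b.IsPos (-sr θ (act v⁻¹ κ)) :=
        hθ.isPos_of_pr_pos (by rw [pr_neg_left, pr_sr_self, h10]; decide)
      refine notMem_support_of_eq_add h9 h11 ?_ hα
      rw [root_neg_sr h10, hκ']; abel
    · have h9 : pr x θ = -1 := by omega
      have h10 := hst _ (sr_mem_minRoots h9 (ex.symm ▸ hε)) (act v⁻¹ κ) (by
        rw [hκ', root_sr, h9]; module)
      have := one_le_pr_of_mem_minRoots h10
      omega
  · intro he
    have hμθ : μ ≠ θ := by
      rintro rfl
      rw [sub_self] at he
      exact (rootSystem H).ne_zero _ he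
    have hαθ : α ≠ θ := by
      rintro rfl
      rw [hv.act_eq] at he
      exact (rootSystem H).ne_zero α
        (by simpa only [left_eq_add, sub_eq_add_neg, neg_eq_zero] using he)
    have h1 := hθ.pr_le_one hαθ
    have h2 : pr α θ = 1 := by omega
    refine ⟨hα, ?_, ?_⟩
    · rintro (h | ⟨-, h⟩)
      · exact hαθ h
      · have h3 : act v (sr θ α) = -θ := by
          rw [← root_inj, act_sub v (γ := α) (ν := θ) (by rw [root_sr, h2, one_smul]), he,
            hv.act_eq, root_neg]
          abel
        rw [h3, isPos_neg] at h
        exact h hθ.1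
    · rintro γ (rfl | ⟨h3, h4⟩) κ hκ
      · have h3 : pr κ γ = 1 := by rw [pr_sub hκ, pr_self, h2]; rfl
        refine .inr ⟨h3, ?_⟩
        have h4 : rt (sr γ κ) = rt (-α) := by rw [root_sr, h3, hκ, root_neg]; module
        rw [root_inj.1 h4]
        have h5 : rt (act v (-α)) = rt γ - rt μ := by rw [act_neg, root_neg, he]; abel
        have h6 := b.height_sub h5
        have h7 := hθ.height_lt hμθ
        exact height_pos.1 (by omega)
      · exfalso
        refine hθ.add_ne (κ := act v κ) h4 ?_
        rw [act_sub v hκ, he, act_sub v (γ := γ) (ν := θ) (κ := sr θ γ)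
          (by rw [root_sr, h3, one_smul]), hv.act_eq]
        abel

lemma stabSimple_inter (hθ : IsHighestRoot b θ) (hμ : b.IsPos μ) (hv : IsMinRep b θ μ v) :
    stabSimple b (minRoots b θ v) ∩ {α | rootIp α θ = 0} =
      {α | α ∈ b.support ∧ act v α ∈ b.support ∧ rootIp α θ = 0} := by
  ext α
  simp only [Set.mem_inter_iff, Set.mem_ofPred_eq, rootIp_eq_zero]
  constructor
  · rintro ⟨h, h0⟩
    exact ⟨h.1, (mem_stabSimple_iff_of_orthogonal hθ hμ hv h.1 h0).1 h, h0⟩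
  · rintro ⟨h1, h2, h0⟩
    exact ⟨(mem_stabSimple_iff_of_orthogonal hθ hμ hv h1 h0).2 h2, h0⟩

/-- `v` identifies the simple roots orthogonal to `θ` with simple image and the simple roots
orthogonal to `μ`: both `v` and `v⁻¹` preserve positivity on the orthogonal roots. -/
lemma transported_eq (hθ : IsHighestRoot b θ) (hv : IsMinRep b θ μ v) :
    transported b v μ = {α | α ∈ b.support ∧ act v α ∈ b.support ∧ rootIp α θ = 0} := by
  ext γ
  constructor
  · rintro ⟨β, hβ, h0, rfl⟩
    have hβ' := RootPairing.Base.isPos_of_mem_support hβ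
    have h1 : rootIp (act v⁻¹ β) θ = 0 := by
      rw [← rootIp_act v, act_act_inv, hv.act_eq, h0]
    have h2 := rootIp_eq_zero.1 h1
    refine ⟨?_, by rwa [act_act_inv], h1⟩
    have h3 : b.IsPos (act v⁻¹ β) := by
      by_contra hn
      have := hv.isPos _ (isPos_neg.2 hn) (by rw [pr_neg_left, h2]; rfl)
      rw [act_neg, act_act_inv, isPos_neg] at this
      exact this hβ'
    by_contra hs
    obtain ⟨ν, α, hν, hα, h4⟩ := exists_eq_add_of_notMem_support h3 hs
    replace hα := RootPairing.Base.isPos_of_mem_support hα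
    have h5 := pr_add h4 θ
    have h6 := hθ.pr_nonneg hν
    have h7 := hθ.pr_nonneg hα
    have h8 := act_add v h4
    rw [act_act_inv] at h8
    exact notMem_support_of_eq_add (hv.isPos ν hν (by omega)) (hv.isPos α hα (by omega)) h8 hβ
  · rintro ⟨h1, h2, h0⟩
    exact ⟨act v γ, h2, by rw [← hv.act_eq, rootIp_act, h0], (act_inv_act v γ).symm⟩

lemma stabSimple_eq_transported (hθ : IsHighestRoot b θ) (hμ : b.IsPos μ)
    (hv : IsMinRep b θ μ v) (h : pr μ θ = 0 ∨ μ = θ) :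
    stabSimple b (minRoots b θ v) = transported b v μ := by
  rw [transported_eq hθ hv, ← stabSimple_inter hθ hμ hv, eq_comm, Set.inter_eq_left]
  intro α hα
  change rootIp α θ = 0
  rw [rootIp_eq_zero]
  by_contra h0
  have h1 := (mem_stabSimple_iff_of_not_orthogonal hθ hμ hv hα.1 h0).1 hα
  rcases h with h | rfl
  · have h2 := pr_sub h1 θ
    rw [h, pr_self] at h2
    have h3 := hθ.eq_of_two_le (γ := -act v α) (by rw [pr_neg_left]; omega)
    rw [neg_eq_iff_eq_neg] at h3
    rw [h3, root_neg] at h1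
    refine (rootSystem H).ne_zero μ ?_
    rw [← sub_add_cancel (rt μ) (rt θ), ← h1, neg_add_cancel]
  · rw [sub_self] at h1
    exact (rootSystem H).ne_zero _ h1

lemma rootIp_self_eq (hv : act v θ = μ) : rootIp μ μ = rootIp θ θ := by
  rw [← hv, rootIp_act]

lemma pr_comm_of_act_eq (hv : act v θ = μ) : pr θ μ = pr μ θ := by
  have h1 := two_mul_rootIp θ μ
  have h2 := two_mul_rootIp μ θ
  rw [rootIp_comm, h2, rootIp_self_eq hv] at h1
  exact_mod_cast (mul_right_cancel₀ (rootIp_self_pos θ).ne' h1).symm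

/-- If `μ ≠ θ` is not orthogonal to `θ`, then `θ - v⁻¹ θ` is a simple root. -/
lemma exists_simple_act_eq (hθ : IsHighestRoot b θ) (hμ : b.IsPos μ)
    (hv : IsMinRep b θ μ v) (h0 : pr μ θ ≠ 0) (hne : μ ≠ θ) :
    ∃ x ∈ b.support, pr x θ = 1 ∧ rt (act v x) = rt μ - rt θ := by
  have h1 := hθ.pr_nonneg hμ
  have h2 := hθ.pr_le_one hne
  have h3 : pr θ μ = 1 := by rw [pr_comm_of_act_eq hv.act_eq]; omega
  obtain ⟨ε, hε⟩ := exists_root_sub (γ := θ) (ν := μ) (by omega) hne.symm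
  have hvx : rt (act v (act v⁻¹ (-ε))) = rt μ - rt θ := by
    rw [act_act_inv, root_neg, hε, neg_sub]
  set x := act v⁻¹ (-ε)
  have h4 : pr x θ = 1 := by
    rw [← pr_act v, hv.act_eq, pr_sub hvx, h3, pr_self]; rfl
  have h5 := hθ.isPos_of_pr_pos (γ := x) (by omega)
  refine ⟨x, ?_, h4, hvx⟩
  -- A summand of `x` orthogonal to `θ` would give a positive root that can be added to `θ`.
  by_contra hs
  obtain ⟨y, α, hy, hα, h6⟩ := exists_eq_add_of_notMem_support h5 hs
  replace hα := RootPairing.Base.isPos_of_mem_support hα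
  have key : ∀ y₀ y₁ : H.root, b.IsPos y₀ → pr y₀ θ = 0 → pr y₁ θ = 1 →
      rt x = rt y₀ + rt y₁ → False := by
    intro y₀ y₁ h7 h8 h9 h10
    refine hθ.add_ne (κ := act v (-sr θ y₁)) (hv.isPos y₀ h7 h8) ?_
    have h11 := act_add v h10
    rw [hvx] at h11
    rw [act_sub v (root_neg_sr h9), hv.act_eq,
      show rt (act v y₁) = rt μ - rt θ - rt (act v y₀) by rw [h11]; abel]
    abel
  have h7 := pr_add h6 θ
  have h8 := hθ.pr_nonneg hy
  have h9 := hθ.pr_nonneg hα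
  rcases h8.eq_or_lt with h10 | h10
  · exact key y α hy h10.symm (by omega) h6
  · exact key α y hα (by omega) (by omega) (h6.trans (add_comm _ _))

lemma stabSimple_eq_union (hθ : IsHighestRoot b θ) (hμ : b.IsPos μ) (hv : IsMinRep b θ μ v)
    {x : H.root} (hx : x ∈ b.support) (h1 : pr x θ ≠ 0) (h2 : rt (act v x) = rt μ - rt θ) :
    stabSimple b (minRoots b θ v) = {x} ∪ transported b v μ := by
  rw [transported_eq hθ hv, ← stabSimple_inter hθ hμ hv]
  ext α
  simp only [Set.singleton_union, Set.mem_insert_iff, Set.mem_inter_iff, Set.mem_ofPred_eq,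
    rootIp_eq_zero]
  constructor
  · intro h
    by_cases h0 : pr α θ = 0
    · exact .inr ⟨h, h0⟩
    · left
      have h3 := (mem_stabSimple_iff_of_not_orthogonal hθ hμ hv h.1 h0).1 h
      exact act_injective v (root_inj.1 (h3.trans h2.symm))
  · rintro (rfl | h)
    · exact (mem_stabSimple_iff_of_not_orthogonal hθ hμ hv hx h1).2 h2
    · exact h.1

/-! ### Sums of root spaces -/

/-- The sum of the weight spaces with weights in `s`. -/
def sumSpaces (s : Set (H → ℂ)) : Submodule ℂ L := ⨆ χ ∈ s, (rootSpace H χ).toSubmodule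

lemma rootSpace_le_sumSpaces {s : Set (H → ℂ)} {χ : H → ℂ} (h : χ ∈ s) :
    (rootSpace H χ).toSubmodule ≤ sumSpaces s :=
  le_iSup₂_of_le χ h le_rfl

lemma eq_zero_of_mem_sumSpaces {s : Set (H → ℂ)} {χ : H → ℂ} (h : χ ∉ s) {x : L}
    (hx : x ∈ rootSpace H χ) (hs : x ∈ sumSpaces s) : x = 0 := by
  have h1 := LieSubmodule.iSupIndep_toSubmodule.2 (LieModule.iSupIndep_genWeightSpace ℂ H L)
  have h2 := h1.disjoint_biSup h
  exact Submodule.disjoint_def.1 h2 x hx hs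

lemma mem_of_rootSpace_le {s : Set (H → ℂ)} (γ : LieModule.Weight ℂ H L)
    (h : (rootSpace H γ).toSubmodule ≤ sumSpaces s) : (γ : H → ℂ) ∈ s := by
  by_contra hn
  obtain ⟨x, hx, hx0⟩ := γ.exists_ne_zero
  exact hx0 (eq_zero_of_mem_sumSpaces hn hx (h hx))

lemma sumSpaces_induction {s : Set (H → ℂ)} {p : L → Prop} {x : L} (hx : x ∈ sumSpaces s)
    (mem : ∀ χ ∈ s, ∀ y ∈ rootSpace H χ, p y) (zero : p 0)
    (add : ∀ y z, p y → p z → p (y + z)) : p x := by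
  unfold sumSpaces at hx
  rw [iSup_subtype'] at hx
  exact Submodule.iSup_induction _ (motive := p) hx (fun χ y hy => mem χ.1 χ.2 y hy) zero add

lemma lie_mem_sumSpaces {s t u : Set (H → ℂ)}
    (h : ∀ χ ∈ s, ∀ ψ ∈ t, χ + ψ ∈ u ∨ rootSpace H (χ + ψ) = ⊥) {x y : L}
    (hx : x ∈ sumSpaces s) (hy : y ∈ sumSpaces t) : ⁅x, y⁆ ∈ sumSpaces u := by
  refine sumSpaces_induction (p := fun x => ⁅x, y⁆ ∈ sumSpaces u) hx (fun χ hχ x hx => ?_) (by simp)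
    fun y z h1 h2 => by rw [add_lie]; exact add_mem h1 h2
  refine sumSpaces_induction (p := fun y => ⁅x, y⁆ ∈ sumSpaces u) hy (fun ψ hψ y hy => ?_) (by simp)
    fun y z h1 h2 => by rw [lie_add]; exact add_mem h1 h2
  have h1 : ⁅x, y⁆ ∈ rootSpace H (χ + ψ) := lie_mem_genWeightSpace_of_mem_genWeightSpace hx hy
  rcases h χ hχ ψ hψ with h2 | h2
  · exact rootSpace_le_sumSpaces h2 h1
  · rw [h2] at h1
    rw [(LieSubmodule.mem_bot _).1 h1]
    exact zero_mem _

/-- The roots in `I`, as functions on the Cartan subalgebra. -/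
def weights (I : Set H.root) : Set (H → ℂ) := (fun γ : H.root => (γ.1 : H → ℂ)) '' I

lemma coe_weight_injective : Function.Injective fun γ : H.root => (γ.1 : H → ℂ) :=
  fun _ _ h => Subtype.ext (DFunLike.coe_injective h)

lemma mem_weights {I : Set H.root} {γ : H.root} : (γ.1 : H → ℂ) ∈ weights I ↔ γ ∈ I :=
  coe_weight_injective.mem_set_image

lemma weight_ne_zero (γ : H.root) : (γ.1 : H → ℂ) ≠ 0 := H.isNonZero_coe_root γ

lemma zero_notMem_weights {I : Set H.root} : (0 : H → ℂ) ∉ weights I := by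
  rintro ⟨γ, -, h⟩
  exact weight_ne_zero γ h

lemma root_eq_add_iff {γ ν κ : H.root} :
    rt κ = rt γ + rt ν ↔ (κ.1 : H → ℂ) = γ.1 + ν.1 := by
  constructor
  · intro h
    funext x
    exact LinearMap.congr_fun h x
  · intro h
    ext x
    exact congrFun h x

lemma coe_neg_root (γ : H.root) : ((-γ : H.root).1 : H → ℂ) = -(γ.1 : H → ℂ) := by
  funext x
  exact LinearMap.congr_fun (root_neg γ) x

lemma add_cases (γ ν : H.root) : (γ.1 + ν.1 : H → ℂ) = 0 ∨
    (∃ κ : H.root, rt κ = rt γ + rt ν) ∨ rootSpace H (γ.1 + ν.1 : H → ℂ) = ⊥ := by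
  by_cases h : rootSpace H (γ.1 + ν.1 : H → ℂ) = ⊥
  · exact .inr (.inr h)
  by_cases h0 : (γ.1 + ν.1 : H → ℂ) = 0
  · exact .inl h0
  · refine .inr (.inl ⟨⟨⟨γ.1 + ν.1, h⟩, ?_⟩, root_eq_add_iff.2 rfl⟩)
    exact Finset.mem_filter.2 ⟨Finset.mem_univ _, h0⟩

/-- Brackets of root spaces do not vanish when the sum of the roots is a root. -/
lemma lie_ne_zero {α β κ : LieModule.Weight ℂ H L} (hα : α.IsNonZero) (hβ : β.IsNonZero)
    (hκ : (κ : H → ℂ) = α + β) {h e f : L} (ht : IsSl2Triple h e f) (he : e ∈ rootSpace H α)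
    (hf : f ∈ rootSpace H (-α)) {x : L} (hx : x ∈ rootSpace H β) (hx0 : x ≠ 0) : ⁅e, x⁆ ≠ 0 := by
  obtain rfl := ht.h_eq_coroot hα he hf
  -- A nonzero vector `z` at the top of the `α`-string through `β` generates the whole string.
  obtain ⟨z, hz, hz0⟩ := (LieModule.chainTop (α : H → ℂ) β).exists_ne_zero
  have prim : ht.HasPrimitiveVectorWith z (chainLength α β : ℂ) :=
    have := lie_mem_genWeightSpace_of_mem_genWeightSpace he hz
    ⟨hz0, (chainLength_smul _ _ hz).symm,
      by rwa [LieModule.genWeightSpace_add_chainTop _ _ hα] at this⟩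
  have h1 : (1 : ℤ) ≤ LieModule.chainTopCoeff α β := by
    have := (rootSpace_zsmul_add_ne_bot_iff α β hα 1).1 (by
      rw [one_smul, ← hκ]; exact κ.genWeightSpace_ne_bot)
    exact this.1
  obtain ⟨q, hq⟩ : ∃ q : ℕ, LieModule.chainTopCoeff (α : H → ℂ) β = q + 1 :=
    ⟨LieModule.chainTopCoeff (α : H → ℂ) β - 1, by omega⟩
  have hlen : q + 1 ≤ chainLength α β := hq ▸ chainTopCoeff_le_chainLength α β
  have h2 := prim.pow_toEnd_f_ne_zero_of_eq_nat rfl hlen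
  have h3 := prim.pow_toEnd_f_ne_zero_of_eq_nat rfl (i := q) (by omega)
  have h4 : ((LieModule.toEnd ℂ L L f) ^ (q + 1)) z ∈ rootSpace H β := by
    have := toEnd_pow_apply_mem hf hz (q + 1)
    convert this using 2
    rw [LieModule.coe_chainTop', hq]
    module
  obtain ⟨c, hc⟩ := (finrank_eq_one_iff_of_nonzero' (⟨x, hx⟩ : rootSpace H β)
    (by simpa using hx0)).1 (finrank_rootSpace_eq_one β hβ) ⟨_, h4⟩
  replace hc : c • x = ((LieModule.toEnd ℂ L L f) ^ (q + 1)) z := congrArg Subtype.val hc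
  intro h5
  have h6 := prim.lie_e_pow_succ_toEnd_f q
  rw [← hc, lie_smul, h5, smul_zero, eq_comm, smul_eq_zero] at h6
  refine h6.elim (fun h7 => ?_) h3
  rcases mul_eq_zero.1 h7 with h8 | h8
  · exact absurd h8 (by exact_mod_cast Nat.succ_ne_zero q)
  · rw [sub_eq_zero] at h8
    have : chainLength α β = q := by exact_mod_cast h8
    omega

/-! ### Abelian ideals and normalisers in terms of roots -/

lemma toSubmodule_eq_rootSpace_zero : H.toSubmodule = (rootSpace H (0 : H → ℂ)).toSubmodule := by
  rw [rootSpace_zero_eq]; rfl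

lemma cartan_sup_eq (T : Set H.root) :
    H.toSubmodule ⊔ ⨆ γ ∈ T, (rootSpace H γ.1).toSubmodule = sumSpaces (insert 0 (weights T)) := by
  rw [sumSpaces, iSup_insert, weights, iSup_image, toSubmodule_eq_rootSpace_zero]

lemma borel_eq (b : (rootSystem H).Base) :
    borel b = sumSpaces (insert 0 (weights {γ : H.root | b.IsPos γ})) := cartan_sup_eq _

lemma add_weight_ne_zero {γ ν : H.root} (hγ : b.IsPos γ) (hν : b.IsPos ν) :
    (γ.1 + ν.1 : H → ℂ) ≠ 0 := by
  intro h
  refine ne_neg_of_isPos hγ hν (coe_weight_injective ?_)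
  change (γ.1 : H → ℂ) = (-ν : H.root).1
  rw [coe_neg_root]
  exact eq_neg_of_add_eq_zero_left h

/-- An upper set of positive roots, no two of which add up to a root, spans an abelian ideal. -/
lemma exists_isAbelianIdeal {I : Set H.root} (hpos : ∀ γ ∈ I, b.IsPos γ)
    (hup : ∀ γ ∈ I, ∀ α κ : H.root, b.IsPos α → rt κ = rt α + rt γ → κ ∈ I)
    (hab : ∀ γ ∈ I, ∀ γ' ∈ I, ∀ κ : H.root, rt κ ≠ rt γ + rt γ') :
    ∃ 𝔞 : LieSubalgebra ℂ L, 𝔞.toSubmodule = sumSpaces (weights I) ∧ IsAbelianIdeal b 𝔞 := by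
  have h0 : ∀ x ∈ sumSpaces (weights I), ∀ y ∈ sumSpaces (weights I), ⁅x, y⁆ = 0 := by
    intro x hx y hy
    have : ⁅x, y⁆ ∈ sumSpaces (∅ : Set (H → ℂ)) := by
      refine lie_mem_sumSpaces ?_ hx hy
      rintro _ ⟨γ, hγ, rfl⟩ _ ⟨γ', hγ', rfl⟩
      rcases add_cases γ γ' with h | ⟨κ, h⟩ | h
      · exact absurd h (add_weight_ne_zero (hpos γ hγ) (hpos γ' hγ'))
      · exact absurd h (hab γ hγ γ' hγ' κ)
      · exact .inr h
    simpa [sumSpaces] using this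
  refine ⟨{ sumSpaces (weights I) with lie_mem' := fun {x y} hx hy => ?_ }, rfl, ?_, ?_, h0⟩
  · rw [h0 x hx y hy]; exact zero_mem (sumSpaces (weights I))
  · change sumSpaces (weights I) ≤ _
    rw [borel_eq]
    refine iSup₂_le ?_
    rintro _ ⟨γ, hγ, rfl⟩
    exact rootSpace_le_sumSpaces (.inr ⟨γ, hpos γ hγ, rfl⟩)
  · intro x hx y hy
    rw [borel_eq] at hx
    change ⁅x, y⁆ ∈ sumSpaces (weights I)
    refine lie_mem_sumSpaces ?_ hx (show y ∈ sumSpaces (weights I) from hy)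
    rintro _ (rfl | ⟨α, hα, rfl⟩) _ ⟨γ, hγ, rfl⟩
    · exact .inl ⟨γ, hγ, (zero_add _).symm⟩
    · rcases add_cases α γ with h | ⟨κ, h⟩ | h
      · exact absurd h (add_weight_ne_zero hα (hpos γ hγ))
      · exact .inl ⟨κ, hup γ hγ α κ hα h, root_eq_add_iff.1 h⟩
      · exact .inr h

lemma idealRoots_eq {I : Set H.root} (hpos : ∀ γ ∈ I, b.IsPos γ) {𝔞 : LieSubalgebra ℂ L}
    (h𝔞 : 𝔞.toSubmodule = sumSpaces (weights I)) : idealRoots b 𝔞 = I := by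
  ext γ
  constructor
  · rintro ⟨-, h⟩
    rw [h𝔞] at h
    exact mem_weights.1 (mem_of_rootSpace_le γ.1 h)
  · intro h
    refine ⟨hpos γ h, ?_⟩
    rw [h𝔞]
    exact rootSpace_le_sumSpaces (mem_weights.2 h)

lemma le_of_subset_idealRoots {I : Set H.root} {𝔞 𝔞' : LieSubalgebra ℂ L}
    (h𝔞 : 𝔞.toSubmodule = sumSpaces (weights I)) (h : I ⊆ idealRoots b 𝔞') : 𝔞 ≤ 𝔞' := by
  rw [← LieSubalgebra.toSubmodule_le_toSubmodule, h𝔞]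
  refine iSup₂_le ?_
  rintro _ ⟨γ, hγ, rfl⟩
  exact (h hγ).2

/-- For a simple root `α`, the root space of `-α` normalises an ideal if and only if `α` is not a
root of the ideal and subtracting `α` does not lead out of it. -/
lemma leviSimple_eq_stabSimple {I : Set H.root} (hpos : ∀ γ ∈ I, b.IsPos γ)
    (hup : ∀ γ ∈ I, ∀ α κ : H.root, b.IsPos α → rt κ = rt α + rt γ → κ ∈ I)
    {𝔞 : LieSubalgebra ℂ L} (h𝔞 : 𝔞.toSubmodule = sumSpaces (weights I)) :
    leviSimple b 𝔞 = stabSimple b I := by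
  have hmem : ∀ x, x ∈ 𝔞 ↔ x ∈ sumSpaces (weights I) := fun x => by
    rw [← h𝔞]; rfl
  ext α
  refine and_congr_right fun hα => ?_
  have hα' := RootPairing.Base.isPos_of_mem_support hα
  have hα0 : (-α : H.root).1.IsNonZero := weight_ne_zero (-α)
  rw [standardLevi, cartan_sup_eq]
  constructor
  · intro h
    have h1 : (rootSpace H (-α.1)).toSubmodule ≤ 𝔞.normalizer.toSubmodule := by
      rcases mem_of_rootSpace_le α.1 h with h2 | h2
      · exact absurd h2 (weight_ne_zero α)
      · exact (mem_weights.1 h2).2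
    have h2 : ∀ x ∈ rootSpace H ((-α : H.root).1 : H → ℂ), ∀ y ∈ 𝔞, ⁅x, y⁆ ∈ 𝔞 := by
      intro x hx y hy
      rw [coe_neg_root] at hx
      exact (LieSubalgebra.mem_normalizer_iff _ _).1 (h1 hx) y hy
    obtain ⟨h, e, f, ht, he, hf⟩ := exists_isSl2Triple_of_weight_isNonZero hα0
    constructor
    · -- If `e` of weight `-α` normalised an ideal that contains `f`, then `[e, f]` would be in it.
      intro hI
      have h3 : f ∈ 𝔞 := by
        rw [hmem]
        refine rootSpace_le_sumSpaces (mem_weights.2 hI) ?_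
        rwa [coe_neg_root, neg_neg] at hf
      have h4 := h2 e he f h3
      have h5 := lie_mem_genWeightSpace_of_mem_genWeightSpace he hf
      rw [hmem] at h4
      rw [add_neg_cancel] at h5
      have h6 := eq_zero_of_mem_sumSpaces zero_notMem_weights h5 h4
      rw [ht.lie_e_f] at h6
      exact ht.h_ne_zero h6
    · intro γ hγ κ hκ
      have hκ' : (κ.1 : H → ℂ) = (-α : H.root).1 + γ.1 := by
        rw [← root_eq_add_iff, hκ, root_neg]; abel
      obtain ⟨x, hx, hx0⟩ := γ.1.exists_ne_zero
      by_contra hn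
      refine lie_ne_zero hα0 (weight_ne_zero γ) hκ' ht he hf hx hx0 ?_
      refine eq_zero_of_mem_sumSpaces (χ := κ.1) (mt mem_weights.1 hn) ?_
        ((hmem _).1 (h2 e he x ((hmem x).2 (rootSpace_le_sumSpaces (mem_weights.2 hγ) hx))))
      rw [hκ']
      exact lie_mem_genWeightSpace_of_mem_genWeightSpace he hx
  · rintro ⟨hI, hst⟩
    refine rootSpace_le_sumSpaces (.inr (mem_weights.2 ⟨?_, ?_⟩))
    · intro x hx
      refine (LieSubalgebra.mem_normalizer_iff _ _).2 fun y hy => ?_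
      rw [hmem] at hy ⊢
      refine lie_mem_sumSpaces ?_ (rootSpace_le_sumSpaces (Set.mem_singleton _) hx) hy
      rintro _ rfl _ ⟨γ, hγ, rfl⟩
      rcases add_cases α γ with h | ⟨κ, h⟩ | h
      · exact absurd h (add_weight_ne_zero hα' (hpos γ hγ))
      · exact .inl ⟨κ, hup γ hγ α κ hα' h, root_eq_add_iff.1 h⟩
      · exact .inr h
    · intro x hx
      have hx' : x ∈ rootSpace H ((-α : H.root).1 : H → ℂ) := by rwa [coe_neg_root]
      refine (LieSubalgebra.mem_normalizer_iff _ _).2 fun y hy => ?_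
      rw [hmem] at hy ⊢
      refine lie_mem_sumSpaces ?_ (rootSpace_le_sumSpaces (Set.mem_singleton _) hx') hy
      rintro _ rfl _ ⟨γ, hγ, rfl⟩
      rcases add_cases (-α) γ with h | ⟨κ, h⟩ | h
      · rw [coe_neg_root, neg_add_eq_zero] at h
        exact absurd (coe_weight_injective h ▸ hγ) hI
      · exact .inl ⟨κ, hst γ hγ κ (by rw [h, root_neg]; abel), root_eq_add_iff.1 h⟩
      · exact .inr h

/-! ### Affine roots and the affine Weyl group -/

lemma rootVec_injective : Function.Injective (rootVec : H.root → V H) := fun _ _ h =>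
  root_inj.1 (congrArg Subtype.val h)

lemma rootVec_neg (γ : H.root) : rootVec (-γ) = -rootVec γ := Subtype.ext (root_neg γ)

lemma rootVec_add {γ ν κ : H.root} : rootVec κ = rootVec γ + rootVec ν ↔ rt κ = rt γ + rt ν :=
  Subtype.ext_iff

lemma rootVec_sr (α γ : H.root) :
    rootVec (sr α γ) = rootVec γ - (pr γ α : ℝ) • rootVec α :=
  Subtype.ext <| (root_sr α γ).trans
    (congrArg (rt γ - ·) (Int.cast_smul_eq_zsmul ℝ (pr γ α) (rt α)).symm)

lemma affRoot_inj {γ ν : H.root} {k m : ℤ} : affRoot γ k = affRoot ν m ↔ γ = ν ∧ k = m := by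
  constructor
  · intro h
    have h2 : (k : ℝ) = m := congrArg (fun x : AffV H => x.2.1) h
    exact ⟨rootVec_injective (congrArg Prod.fst h), by exact_mod_cast h2⟩
  · rintro ⟨rfl, rfl⟩
    rfl

lemma neg_affRoot (γ : H.root) (k : ℤ) : -affRoot γ k = affRoot (-γ) (-k) := by
  simp [affRoot, rootVec_neg]

lemma affRoot_add {γ ν κ : H.root} (h : rt κ = rt γ + rt ν) (k m : ℤ) :
    affRoot κ (k + m) = affRoot γ k + affRoot ν m := by
  simp [affRoot, rootVec_add.2 h]

lemma affRoot_add_delta (γ : H.root) (k m : ℤ) :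
    affRoot γ (k + m) = affRoot γ k + (m : ℝ) • delta H := by
  simp [affRoot, delta]

lemma affRoot_eq_add {γ ν κ : H.root} {k m n : ℤ} (h : affRoot κ n = affRoot γ k + affRoot ν m) :
    rt κ = rt γ + rt ν ∧ n = k + m := by
  have h2 : (n : ℝ) = k + m := congrArg (fun x : AffV H => x.2.1) h
  exact ⟨rootVec_add.1 (congrArg Prod.fst h), by exact_mod_cast h2⟩

lemma emb_eq (γ : H.root) : emb γ = affRoot γ 0 := by simp [emb, affRoot]

lemma delta_sub_emb (γ : H.root) : delta H - emb γ = affRoot (-γ) 1 := by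
  simp [emb, affRoot, delta, rootVec_neg]

lemma two_smul_delta_sub_emb (γ : H.root) : (2 : ℝ) • delta H - emb γ = affRoot (-γ) 2 := by
  simp [emb, affRoot, delta, rootVec_neg]

lemma affRoot_mem_affPos {γ : H.root} {k : ℤ} :
    affRoot γ k ∈ affPos b ↔ 1 ≤ k ∨ (k = 0 ∧ b.IsPos γ) := by
  constructor
  · rintro ⟨ν, m, h, h'⟩
    obtain ⟨rfl, rfl⟩ := affRoot_inj.1 h
    exact h'
  · intro h
    exact ⟨γ, k, rfl, h⟩

lemma neg_affRoot_mem_affPos {γ : H.root} {k : ℤ} :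
    -affRoot γ k ∈ affPos b ↔ k ≤ -1 ∨ (k = 0 ∧ ¬ b.IsPos γ) := by
  rw [neg_affRoot, affRoot_mem_affPos, isPos_neg]
  constructor <;> rintro (h | ⟨h, h'⟩)
  · exact .inl (by omega)
  · exact .inr ⟨by omega, h'⟩
  · exact .inl (by omega)
  · exact .inr ⟨by omega, h'⟩

lemma neg_notMem_affPos {x : AffV H} (hx : x ∈ affPos b) : -x ∉ affPos b := by
  obtain ⟨γ, k, rfl, h⟩ := hx
  rw [neg_affRoot_mem_affPos]
  rintro (h' | ⟨h', h''⟩)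
  · omega
  · rcases h with h | ⟨-, h⟩
    · omega
    · exact h'' h

/-- Pairing with a fixed vector, as a linear functional. -/
def affPair (a : AffV H) : AffV H →ₗ[ℝ] ℝ where
  toFun x := affIp x a
  map_add' x y := by simp [affIp, ip]; ring
  map_smul' c x := by simp [affIp, ip]; ring

@[simp] lemma affPair_apply (a x : AffV H) : affPair a x = affIp x a := rfl

lemma affIp_comm (x y : AffV H) : affIp x y = affIp y x := by
  have : ip x.1 y.1 = ip y.1 x.1 := (((rootSystem H).rootFormIn_isSymm ℝ).eq _ _).symm
  rw [affIp, affIp, this]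
  ring

lemma affIp_affRoot (γ ν : H.root) (k m : ℤ) : affIp (affRoot γ k) (affRoot ν m) = rootIp γ ν := by
  simp [affIp, affRoot, rootIp]

/-- The reflection in the affine root `α + mδ`. -/
def affRefl (α : H.root) (m : ℤ) : AffV H ≃ₗ[ℝ] AffV H :=
  Module.reflection (x := (2 / affIp (affRoot α m) (affRoot α m)) • affRoot α m)
    (f := affPair (affRoot α m)) (by
      have := (rootIp_self_pos α).ne'
      rw [map_smul, affPair_apply, smul_eq_mul, affIp_affRoot]
      field_simp)

lemma affRefl_apply (α : H.root) (m : ℤ) (x : AffV H) : affRefl α m x = x -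
    affIp x (affRoot α m) • ((2 / affIp (affRoot α m) (affRoot α m)) • affRoot α m) :=
  Module.reflection_apply _ _

lemma affRefl_mul_self (α : H.root) (m : ℤ) : affRefl α m * affRefl α m = 1 :=
  LinearEquiv.ext fun x => Module.involutive_reflection _ x

lemma affRefl_affRoot (α γ : H.root) (m k : ℤ) :
    affRefl α m (affRoot γ k) = affRoot (sr α γ) (k - pr γ α * m) := by
  have h1 := (rootIp_self_pos α).ne'
  have h2 : rootIp γ α * (2 / rootIp α α) = pr γ α := by
    rw [mul_div_assoc', mul_comm, two_mul_rootIp]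
    field_simp
  rw [affRefl_apply, affIp_affRoot, affIp_affRoot, smul_smul, h2]
  simp [affRoot, rootVec_sr]

lemma affRefl_affRoot_self (α : H.root) (m : ℤ) : affRefl α m (affRoot α m) = -affRoot α m := by
  rw [affRefl_affRoot, sr_self, pr_self, neg_affRoot]
  congr 1
  ring

/-- The affine simple roots as pairs: `(α, 0)` with `α` simple, and `(-θ, 1)`. -/
def affIdx (b : (rootSystem H).Base) (θ : H.root) : Set (H.root × ℤ) :=
  {p | (p.1 ∈ b.support ∧ p.2 = 0) ∨ p = (-θ, 1)}

lemma affWeyl_eq (b : (rootSystem H).Base) (θ : H.root) :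
    affWeyl b θ = Subgroup.closure ((fun p : H.root × ℤ => affRefl p.1 p.2) '' affIdx b θ) := by
  unfold affWeyl
  congr 1
  ext g
  constructor
  · rintro ⟨α, (⟨γ, hγ, rfl⟩ | hα), h⟩
    · refine ⟨(γ, 0), .inl ⟨hγ, rfl⟩, LinearEquiv.ext fun x => ?_⟩
      rw [affRefl_apply, h, emb_eq]
    · rw [Set.mem_singleton_iff] at hα
      refine ⟨(-θ, 1), .inr rfl, LinearEquiv.ext fun x => ?_⟩
      rw [affRefl_apply, h, hα, delta_sub_emb]
  · rintro ⟨⟨γ, k⟩, (⟨h1, h2⟩ | h1), rfl⟩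
    · refine ⟨emb γ, .inl ⟨γ, h1, rfl⟩, fun x => ?_⟩
      simp only at h2
      rw [emb_eq, h2, affRefl_apply]
    · obtain ⟨rfl, rfl⟩ := Prod.mk_inj.1 h1
      exact ⟨_, .inr rfl, fun x => by rw [affRefl_apply, delta_sub_emb]⟩

lemma affRefl_mem_affWeyl {p : H.root × ℤ} (hp : p ∈ affIdx b θ) :
    affRefl p.1 p.2 ∈ affWeyl b θ := by
  rw [affWeyl_eq]
  exact Subgroup.subset_closure ⟨p, hp, rfl⟩

lemma affRefl_isometry (α : H.root) (m : ℤ) (x y : AffV H) :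
    affIp (affRefl α m x) (affRefl α m y) = affIp x y := by
  have h1 : affIp (affRoot α m) (affRoot α m) ≠ 0 := by
    rw [affIp_affRoot]
    exact (rootIp_self_pos α).ne'
  set a := affRoot α m with ha
  rw [affRefl_apply, affRefl_apply, ← ha]
  have e1 : ∀ z w : AffV H, ∀ c : ℝ, affIp (z - c • a) w = affIp z w - c * affIp a w :=
    fun z w c => by
      have := map_sub (affPair w) z (c • a)
      rwa [map_smul] at this
  have e2 : ∀ z w : AffV H, ∀ c : ℝ, affIp z (w - c • a) = affIp z w - c * affIp z a :=
    fun z w c => by rw [affIp_comm, e1, affIp_comm w, affIp_comm a]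
  rw [smul_smul, smul_smul, e1, e2, e2, affIp_comm a y]
  field_simp
  ring

lemma affRefl_delta (α : H.root) (m : ℤ) : affRefl α m (delta H) = delta H := by
  have : affIp (delta H) (affRoot α m) = 0 := by simp [affIp, delta, affRoot, ip]
  rw [affRefl_apply, this, zero_smul, sub_zero]

/-- Elements of the affine Weyl group preserve the form, fix `δ` and permute the affine roots. -/
lemma affWeyl_props {w : AffV H ≃ₗ[ℝ] AffV H} (hw : w ∈ affWeyl b θ) :
    (∀ x y, affIp (w x) (w y) = affIp x y) ∧ w (delta H) = delta H ∧
      ∀ (γ : H.root) (k : ℤ), ∃ (ν : H.root) (m : ℤ), w (affRoot γ k) = affRoot ν m := by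
  rw [affWeyl_eq] at hw
  have key : ∀ p : H.root × ℤ, (∀ x y, affIp (affRefl p.1 p.2 x) (affRefl p.1 p.2 y) = affIp x y) ∧
      affRefl p.1 p.2 (delta H) = delta H ∧ ∀ (γ : H.root) (k : ℤ),
        ∃ (ν : H.root) (m : ℤ), affRefl p.1 p.2 (affRoot γ k) = affRoot ν m :=
    fun p => ⟨affRefl_isometry _ _, affRefl_delta _ _, fun γ k => ⟨_, _, affRefl_affRoot _ _ _ _⟩⟩
  induction hw using Subgroup.closure_induction'' with
  | one => exact ⟨fun _ _ => rfl, rfl, fun γ k => ⟨γ, k, rfl⟩⟩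
  | mem x hx =>
    obtain ⟨p, -, rfl⟩ := hx
    exact key p
  | inv_mem x hx =>
    obtain ⟨p, -, rfl⟩ := hx
    rw [inv_eq_of_mul_eq_one_left (affRefl_mul_self p.1 p.2)]
    exact key p
  | mul x y _ _ hx hy =>
    refine ⟨fun z w => (hx.1 _ _).trans (hy.1 _ _), ?_, fun γ k => ?_⟩
    · rw [LinearEquiv.mul_apply, hy.2.1, hx.2.1]
    · obtain ⟨ν, m, h1⟩ := hy.2.2 γ k
      obtain ⟨ν', m', h2⟩ := hx.2.2 ν m
      exact ⟨ν', m', by rw [LinearEquiv.mul_apply, h1, h2]⟩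

lemma sr_neg (α γ : H.root) : sr (-α) γ = sr α γ := by
  rw [← root_inj, root_sr, root_sr, pr_neg_right, root_neg, neg_smul, smul_neg, neg_neg]

lemma affRefl_zero (γ : H.root) (k : ℤ) :
    affRefl (-θ) 1 (affRoot γ k) = affRoot (sr θ γ) (k + pr γ θ) := by
  rw [affRefl_affRoot, sr_neg, pr_neg_right]
  congr 1
  ring

lemma IsHighestRoot.isPos_sr_of_neg (hθ : IsHighestRoot b θ) {γ : H.root} (h : pr γ θ < 0) :
    b.IsPos (sr θ γ) :=
  hθ.isPos_of_pr_pos (by rw [pr_sr_self]; omega)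

lemma IsHighestRoot.eq_neg_of_le (hθ : IsHighestRoot b θ) {γ : H.root} (h : pr γ θ ≤ -2) :
    γ = -θ := by
  rw [← hθ.eq_of_two_le (γ := -γ) (by rw [pr_neg_left]; omega), neg_neg]

/-- The reflection in `α₀` permutes the positive affine roots other than `α₀`. -/
lemma IsHighestRoot.affRefl_zero_mem (hθ : IsHighestRoot b θ) {x : AffV H} (hx : x ∈ affPos b)
    (hne : x ≠ affRoot (-θ) 1) : affRefl (-θ) 1 x ∈ affPos b := by
  obtain ⟨γ, k, rfl, h⟩ := hx
  rw [affRefl_zero, affRoot_mem_affPos]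
  rcases lt_or_ge (pr γ θ) 0 with hneg | hnn
  · have h1 := hθ.isPos_sr_of_neg hneg
    suffices 0 ≤ k + pr γ θ by
      rcases this.eq_or_lt with h2 | h2
      · exact .inr ⟨h2.symm, h1⟩
      · exact .inl h2
    have hk : 1 ≤ k := by
      refine h.resolve_right fun h2 => ?_
      have := hθ.pr_nonneg h2.2
      omega
    by_cases h3 : pr γ θ ≤ -2
    · have h4 := hθ.eq_neg_of_le h3
      subst h4
      have h5 : k ≠ 1 := fun h5 => hne (by rw [h5])
      rw [pr_neg_left, pr_self]
      omega
    · omega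
  · rcases h with h | ⟨rfl, h⟩
    · exact .inl (by omega)
    · rcases hnn.eq_or_lt with h2 | h2
      · exact .inr ⟨by omega, by rwa [sr_of_pr_eq_zero h2.symm]⟩
      · exact .inl (by omega)

/-- The affine simple reflections satisfy the axioms of a simple system. -/
lemma IsHighestRoot.isSimpleSystem_affine (hθ : IsHighestRoot b θ) :
    IsSimpleSystem (affIdx b θ) (fun p => affRefl p.1 p.2) (fun p => affRoot p.1 p.2)
      (affPos b) where
  mul_self p _ := affRefl_mul_self _ _
  smul_self p _ := affRefl_affRoot_self _ _
  smul_mem := by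
    rintro ⟨α, m⟩ (⟨hα, rfl : m = 0⟩ | hp) x hx hne
    · obtain ⟨γ, k, rfl, h⟩ := hx
      change affRefl α 0 (affRoot γ k) ∈ affPos b
      rw [affRefl_affRoot, mul_zero, sub_zero, affRoot_mem_affPos]
      refine h.imp_right fun ⟨h1, h2⟩ => ⟨h1, isPos_sr hα h2 ?_⟩
      rintro rfl
      exact hne (by rw [h1])
    · obtain ⟨rfl, rfl⟩ := Prod.mk_inj.1 hp
      exact hθ.affRefl_zero_mem hx hne
  mem := by
    rintro ⟨α, m⟩ (⟨hα, rfl : m = 0⟩ | hp)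
    · exact affRoot_mem_affPos.2 (.inr ⟨rfl, RootPairing.Base.isPos_of_mem_support hα⟩)
    · obtain ⟨rfl, rfl⟩ := Prod.mk_inj.1 hp
      exact affRoot_mem_affPos.2 (.inl le_rfl)
  neg_notMem _ hx := neg_notMem_affPos hx
  conj := by
    intro g hg p _ q _ h
    rw [← affWeyl_eq] at hg
    have h' : g (affRoot p.1 p.2) = affRoot q.1 q.2 := h
    refine LinearEquiv.ext fun x => ?_
    have hi := (affWeyl_props hg).1
    rw [LinearEquiv.mul_apply, LinearEquiv.mul_apply, affRefl_apply, affRefl_apply, ← h', hi, hi,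
      map_sub, map_smul, map_smul]

lemma IsHighestRoot.exists_affine_word (hθ : IsHighestRoot b θ) {w : AffV H ≃ₗ[ℝ] AffV H}
    (hw : w ∈ affWeyl b θ) : ∃ l : List (H.root × ℤ), (∀ p ∈ l, p ∈ affIdx b θ) ∧
      (l.map fun p => affRefl p.1 p.2).prod = w :=
  hθ.isSimpleSystem_affine.exists_word (by rwa [← affWeyl_eq])

/-- A positive affine root that is not simple is the sum of a simple affine root and of a positive
affine root or a positive multiple of `δ`. -/
lemma IsHighestRoot.exists_affine_decomposition (hθ : IsHighestRoot b θ) {γ : H.root} {k : ℤ}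
    (h : affRoot γ k ∈ affPos b) (hs : (γ, k) ∉ affIdx b θ) : ∃ p ∈ affIdx b θ,
      (∃ (ν : H.root) (n : ℤ), affRoot ν n ∈ affPos b ∧ rt γ = rt p.1 + rt ν ∧ k = p.2 + n) ∨
      (γ = p.1 ∧ p.2 + 1 ≤ k) := by
  rw [affRoot_mem_affPos] at h
  rcases h with hk | ⟨rfl, hγ⟩
  · by_cases hγ : b.IsPos γ
    · by_cases hsimple : γ ∈ b.support
      · exact ⟨(γ, 0), .inl ⟨hsimple, rfl⟩, .inr ⟨rfl, by simpa using hk⟩⟩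
      · obtain ⟨ν, α, hν, hα, he⟩ := exists_eq_add_of_notMem_support hγ hsimple
        exact ⟨(α, 0), .inl ⟨hα, rfl⟩, .inl ⟨ν, k, affRoot_mem_affPos.2 (.inl hk),
          he.trans (add_comm _ _), by simp⟩⟩
    · have hn : b.IsPos (-γ) := isPos_neg.2 hγ
      by_cases he : -γ = θ
      · subst he
        have hk1 : k ≠ 1 := fun h => hs (.inr (by rw [h, neg_neg]))
        exact ⟨(- -γ, 1), .inr rfl, .inr ⟨(neg_neg γ).symm, by
          change 1 + 1 ≤ k
          omega⟩⟩
      · rcases (hθ.pr_nonneg hn).eq_or_lt with h0 | h0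
        · obtain ⟨α, hα, h1⟩ := exists_simple_pr_neg hθ hn h0.symm
          obtain ⟨κ, hκ⟩ := exists_root_add h1
            (ne_neg_of_isPos hn (RootPairing.Base.isPos_of_mem_support hα))
          refine ⟨(α, 0), .inl ⟨hα, rfl⟩, .inl ⟨-κ, k, affRoot_mem_affPos.2 (.inl hk), ?_, by simp⟩⟩
          rw [root_neg, hκ, root_neg]
          abel
        · obtain ⟨ε, hε⟩ := exists_root_sub (pr_pos_comm.1 h0) (Ne.symm he)
          refine ⟨(-θ, 1), .inr rfl, .inl ⟨ε, k - 1, affRoot_mem_affPos.2 ?_, ?_, by simp⟩⟩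
          · rcases hk.eq_or_lt with h2 | h2
            · refine .inr ⟨by omega, height_pos.1 ?_⟩
              have := b.height_sub hε
              have := hθ.height_lt he
              omega
            · exact .inl (by omega)
          · rw [hε, root_neg, root_neg]
            abel
  · have hsimple : γ ∉ b.support := fun h => hs (.inl ⟨h, rfl⟩)
    obtain ⟨ν, α, hν, hα, he⟩ := exists_eq_add_of_notMem_support hγ hsimple
    exact ⟨(α, 0), .inl ⟨hα, rfl⟩, .inl ⟨ν, 0, affRoot_mem_affPos.2 (.inr ⟨rfl, hν⟩),
      he.trans (add_comm _ _), by simp⟩⟩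

/-! ### Minuscule elements and rootlets -/

/-- Minuscule elements, in terms of the affine roots `γ + kδ`. -/
lemma isMinuscule_iff {I : Set H.root} {w : AffV H ≃ₗ[ℝ] AffV H} :
    IsMinuscule b θ I w ↔ w ∈ affWeyl b θ ∧
      ∀ (γ : H.root) (k : ℤ), affRoot γ k ∈ affInv b w ↔ k = 1 ∧ -γ ∈ I := by
  refine and_congr_right fun _ => ?_
  have key : ∀ (γ : H.root) (k : ℤ),
      affRoot γ k ∈ (fun γ => delta H - emb γ) '' I ↔ k = 1 ∧ -γ ∈ I := by
    intro γ k
    constructor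
    · rintro ⟨ν, hν, h⟩
      obtain ⟨rfl, rfl⟩ := affRoot_inj.1 ((delta_sub_emb ν).symm.trans h)
      exact ⟨rfl, by rwa [neg_neg]⟩
    · rintro ⟨rfl, h⟩
      exact ⟨-γ, h, (delta_sub_emb _).trans (by rw [neg_neg])⟩
  constructor
  · intro h γ k
    rw [h, key]
  · intro h
    ext x
    constructor
    · intro hx
      obtain ⟨γ, k, rfl, -⟩ := hx.1
      exact (key γ k).2 ((h γ k).1 hx)
    · rintro ⟨γ, hγ, rfl⟩
      simp only [delta_sub_emb]
      exact (h _ _).2 ⟨rfl, by rwa [neg_neg]⟩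

/-- Inversions under left multiplication by the simple reflection that makes `-w x₀` simple. -/
lemma mem_affInv_refl_mul (hθ : IsHighestRoot b θ) {w : AffV H ≃ₗ[ℝ] AffV H}
    {p : H.root × ℤ} (hp : p ∈ affIdx b θ) {x₀ : AffV H} (hx₀ : x₀ ∈ affPos b)
    (h : w x₀ = -affRoot p.1 p.2) (x : AffV H) :
    x ∈ affInv b (affRefl p.1 p.2 * w) ↔ x ∈ affInv b w ∧ x ≠ x₀ := by
  have hs := hθ.isSimpleSystem_affine
  have hinv : ∀ y, affRefl p.1 p.2 (affRefl p.1 p.2 y) = y := fun y =>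
    LinearEquiv.congr_fun (affRefl_mul_self p.1 p.2) y
  have hself : affRefl p.1 p.2 (affRoot p.1 p.2) = -affRoot p.1 p.2 := affRefl_affRoot_self _ _
  have hmem := hs.mem p hp
  simp only [affInv, Set.mem_ofPred_eq, LinearEquiv.mul_apply, and_assoc]
  refine and_congr_right fun hx => ?_
  constructor
  · intro h1
    by_cases he : -(affRefl p.1 p.2 (w x)) = affRoot p.1 p.2
    · have h2 := congrArg (affRefl p.1 p.2) he
      rw [map_neg, hinv, hself, neg_inj, ← neg_eq_iff_eq_neg.2 h, ← map_neg] at h2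
      rw [w.injective h2] at hx
      exact absurd hx (neg_notMem_affPos hx₀)
    · have h2 : affRefl p.1 p.2 (-(affRefl p.1 p.2 (w x))) ∈ affPos b := hs.smul_mem p hp _ h1 he
      rw [map_neg, hinv] at h2
      refine ⟨h2, ?_⟩
      rintro rfl
      rw [h, map_neg, neg_neg, hself] at h1
      exact neg_notMem_affPos hmem h1
  · rintro ⟨h1, h2⟩
    have h3 : affRefl p.1 p.2 (-(w x)) ∈ affPos b := by
      refine hs.smul_mem p hp _ h1 fun he => h2 (w.injective ?_)
      rw [h, ← he, neg_neg]
    rwa [map_neg] at h3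

lemma affWeyl_apply_affRoot_add {w : AffV H ≃ₗ[ℝ] AffV H} (hw : w ∈ affWeyl b θ)
    {γ ν : H.root} {k m : ℤ} (h : w (affRoot γ k) = affRoot ν m) (n : ℤ) :
    w (affRoot γ (k + n)) = affRoot ν (m + n) := by
  rw [affRoot_add_delta, map_add, map_smul, (affWeyl_props hw).2.1, h, affRoot_add_delta]

/-- If `γ` has minimal height among the roots of `J` orthogonal to `θ`, then `w` takes `δ - γ` to
the negative of a simple affine root. -/
lemma exists_affIdx_eq (hθ : IsHighestRoot b θ) {J : Set H.root} (hJ : ∀ γ ∈ J, b.IsPos γ)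
    {w : AffV H ≃ₗ[ℝ] AffV H} (hw : IsMinuscule b θ J w) {γ : H.root} (hγ : γ ∈ J)
    (h0 : pr γ θ = 0) (hmin : ∀ ν ∈ J, pr ν θ = 0 → b.height γ ≤ b.height ν) :
    ∃ p ∈ affIdx b θ, w (affRoot (-γ) 1) = -affRoot p.1 p.2 := by
  obtain ⟨hw, hinv⟩ := isMinuscule_iff.1 hw
  have h1 : affRoot (-γ) 1 ∈ affInv b w := (hinv _ _).2 ⟨rfl, by rwa [neg_neg]⟩
  obtain ⟨ν, k, hν⟩ := (affWeyl_props hw).2.2 γ (-1)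
  have hβ : w (affRoot (-γ) 1) = -affRoot ν k := by
    rw [← hν, ← map_neg, neg_affRoot, neg_neg]
  have hpos : affRoot ν k ∈ affPos b := by
    have := h1.2
    rwa [hβ, neg_neg] at this
  by_cases hs : (ν, k) ∈ affIdx b θ
  · exact ⟨_, hs, hβ⟩
  exfalso
  obtain ⟨p, hp, (⟨κ, n, hy, h2, h3⟩ | ⟨h2, h3⟩)⟩ := hθ.exists_affine_decomposition hpos hs
  · -- `δ - γ` is the sum of two affine roots that `w` makes negative.
    have hpp : affRoot p.1 p.2 ∈ affPos b := hθ.isSimpleSystem_affine.mem p hp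
    have key : ∀ (γ₁ γ₂ : H.root) (k₁ k₂ : ℤ), -(w (affRoot γ₁ k₁)) ∈ affPos b →
        -(w (affRoot γ₂ k₂)) ∈ affPos b → rt (-γ) = rt γ₁ + rt γ₂ → k₁ + k₂ = 1 → 1 ≤ k₁ →
        False := by
      intro γ₁ γ₂ k₁ k₂ hn₁ hn₂ hadd hk hk₁
      obtain ⟨rfl, hm⟩ := (hinv γ₁ k₁).1 ⟨affRoot_mem_affPos.2 (.inl hk₁), hn₁⟩
      have hk₂ : k₂ = 0 := by omega
      have hneg : b.IsPos (-γ₂) := by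
        rw [isPos_neg]
        intro hγ₂
        have := ((hinv γ₂ k₂).1 ⟨affRoot_mem_affPos.2 (.inr ⟨hk₂, hγ₂⟩), hn₂⟩).1
        omega
      have hadd' : rt γ = rt (-γ₁) + rt (-γ₂) := by
        rw [← neg_inj, ← root_neg, hadd, root_neg, root_neg]
        abel
      have e1 := pr_add hadd' θ
      have e2 := hθ.pr_nonneg (hJ _ hm)
      have e3 := hθ.pr_nonneg hneg
      have e4 := hmin _ hm (by omega)
      have e5 := b.height_add hadd'
      have e6 := height_pos.2 hneg
      omega
    obtain ⟨γ₁, k₁, e1⟩ := (affWeyl_props (inv_mem hw)).2.2 (-p.1) (-p.2)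
    obtain ⟨γ₂, k₂, e2⟩ := (affWeyl_props (inv_mem hw)).2.2 (-κ) (-n)
    rw [← neg_affRoot] at e1 e2
    have f1 : w (affRoot γ₁ k₁) = -affRoot p.1 p.2 := by
      rw [← e1]
      exact w.apply_symm_apply _
    have f2 : w (affRoot γ₂ k₂) = -affRoot κ n := by
      rw [← e2]
      exact w.apply_symm_apply _
    have hsum : affRoot (-γ) 1 = affRoot γ₁ k₁ + affRoot γ₂ k₂ := by
      apply w.injective
      rw [map_add, f1, f2, hβ, h3, affRoot_add h2, neg_add]
    obtain ⟨g1, g2⟩ := affRoot_eq_add hsum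
    have n1 : -(w (affRoot γ₁ k₁)) ∈ affPos b := by rwa [f1, neg_neg]
    have n2 : -(w (affRoot γ₂ k₂)) ∈ affPos b := by rwa [f2, neg_neg]
    rcases le_or_gt 1 k₁ with hk | hk
    · exact key γ₁ γ₂ k₁ k₂ n1 n2 g1 g2.symm hk
    · exact key γ₂ γ₁ k₂ k₁ n2 n1 (g1.trans (add_comm _ _)) (by omega) (by omega)
  · -- A simple root plus a multiple of `δ`: a root at level at least `2` would be inverted.
    have e1 : w (affRoot (-γ) 1) = affRoot (-ν) (-k) := by rw [hβ, neg_affRoot]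
    have e2 := affWeyl_apply_affRoot_add hw e1 (k - p.2)
    have hpp : affRoot p.1 p.2 ∈ affPos b := hθ.isSimpleSystem_affine.mem p hp
    have e3 := ((hinv (-γ) (1 + (k - p.2))).1 ⟨affRoot_mem_affPos.2 (.inl (by omega)), by
      rw [e2, neg_affRoot, neg_neg, h2]
      convert hpp using 2
      ring⟩).1
    omega

/-- The roots orthogonal to `θ` can be removed from `J` without changing the rootlet. -/
lemma exists_minuscule_not_orthogonal (hθ : IsHighestRoot b θ) {J : Set H.root}
    (hJ : ∀ γ ∈ J, b.IsPos γ) {w : AffV H ≃ₗ[ℝ] AffV H} (hw : IsMinuscule b θ J w) :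
    ∃ w', IsMinuscule b θ {γ ∈ J | pr γ θ ≠ 0} w' ∧ w' (affRoot (-θ) 2) = w (affRoot (-θ) 2) := by
  induction hn : Set.ncard {γ ∈ J | pr γ θ = 0} using Nat.strong_induction_on generalizing J w with
  | _ n ih =>
    by_cases hne : {γ ∈ J | pr γ θ = 0}.Nonempty
    · obtain ⟨γ, ⟨hγ, h0⟩, hmin⟩ := Set.exists_min_image _ b.height (Set.toFinite _) hne
      obtain ⟨p, hp, hβ⟩ := exists_affIdx_eq hθ hJ hw hγ h0 fun ν h h' => hmin ν ⟨h, h'⟩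
      have hw' := isMinuscule_iff.1 hw
      have h1 : IsMinuscule b θ (J \ {γ}) (affRefl p.1 p.2 * w) := by
        rw [isMinuscule_iff]
        refine ⟨mul_mem (affRefl_mem_affWeyl hp) hw'.1, fun κ k => ?_⟩
        rw [mem_affInv_refl_mul hθ hp (affRoot_mem_affPos.2 (.inl le_rfl)) hβ, hw'.2, and_assoc]
        refine and_congr_right fun hk => ?_
        subst hk
        rw [Set.mem_sdiff, Set.mem_singleton_iff, ne_eq, affRoot_inj]
        simp [neg_eq_iff_eq_neg]
      have h2 : {ν ∈ J \ {γ} | pr ν θ = 0} ⊂ {ν ∈ J | pr ν θ = 0} :=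
        ⟨fun ν h => ⟨h.1.1, h.2⟩, fun h => (h ⟨hγ, h0⟩).1.2 rfl⟩
      obtain ⟨w', h3, h4⟩ := ih _ (hn ▸ Set.ncard_lt_ncard h2) (fun ν h => hJ ν h.1) h1 rfl
      refine ⟨w', ?_, h4.trans ?_⟩
      · convert h3 using 1
        ext ν
        constructor
        · rintro ⟨h5, h6⟩
          exact ⟨⟨h5, fun h => h6 (h ▸ h0)⟩, h6⟩
        · rintro ⟨h5, h6⟩
          exact ⟨h5.1, h6⟩
      · -- The simple root `-w (δ - γ)` is orthogonal to the rootlet, because `γ` is to `θ`.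
        have h5 : affIp (w (affRoot (-θ) 2)) (affRoot p.1 p.2) = 0 := by
          rw [← neg_eq_iff_eq_neg.2 hβ, ← map_neg, (affWeyl_props hw'.1).1, neg_affRoot,
            affIp_affRoot, rootIp_eq_zero, neg_neg, pr_neg_left, pr_eq_zero_comm.1 h0, neg_zero]
        rw [LinearEquiv.mul_apply, affRefl_apply, h5, zero_smul, sub_zero]
    · refine ⟨w, ?_, rfl⟩
      convert hw using 1
      ext ν
      exact ⟨fun h => h.1, fun h => ⟨h, fun h' => hne ⟨ν, h, h'⟩⟩⟩

/-- An element of the affine Weyl group all of whose inversions are finite roots acts through the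
finite Weyl group. -/
lemma exists_weyl_eq (hθ : IsHighestRoot b θ) {u : AffV H ≃ₗ[ℝ] AffV H} (hu : u ∈ affWeyl b θ)
    (h : ∀ (γ : H.root) (k : ℤ), affRoot γ k ∈ affInv b u → k = 0) :
    ∃ v : Weyl H, ∀ (γ : H.root) (k : ℤ), u (affRoot γ k) = affRoot (act v γ) k := by
  obtain ⟨l, hl, rfl⟩ := hθ.exists_affine_word hu
  have hs := hθ.isSimpleSystem_affine
  refine hs.descent_induction (Q := fun u =>
    (∀ (γ : H.root) (k : ℤ), affRoot γ k ∈ affInv b u → k = 0) →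
      ∃ v : Weyl H, ∀ (γ : H.root) (k : ℤ), u (affRoot γ k) = affRoot (act v γ) k)
    (fun _ => ⟨1, fun γ k => by rw [act_one]; rfl⟩) ?_ l hl h
  rintro l - ⟨α, m⟩ hp hn ih hinv
  have hm : m = 0 := hinv α m ⟨hs.mem _ hp, hn⟩
  subst hm
  obtain ⟨v, hv⟩ := ih fun γ k hk => by
    by_cases he : affRoot γ k = affRoot α 0
    · exact (affRoot_inj.1 he).2
    · have h1 : affRefl α 0 (affRoot γ k) ∈ affPos b := hs.smul_mem _ hp _ hk.1 he
      have h2 := hk.2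
      rw [LinearEquiv.mul_apply] at h2
      rw [affRefl_affRoot, mul_zero, sub_zero] at h1 h2
      exact hinv _ _ ⟨h1, h2⟩
  refine ⟨v * RootPairing.weylGroup.ofIdx (rootSystem H) α, fun γ k => ?_⟩
  have h3 := hv (sr α γ) k
  rw [LinearEquiv.mul_apply, affRefl_affRoot, sr_sr, mul_zero, sub_zero] at h3
  rw [h3, act_mul, act_ofIdx]

/-- The roots of an ideal with rootlet `μ` include `minRoots b θ v`. -/
lemma minRoots_subset (hθ : IsHighestRoot b θ) (hv : IsMinRep b θ μ v)
    {J : Set H.root} (hJ : ∀ γ ∈ J, b.IsPos γ) {w : AffV H ≃ₗ[ℝ] AffV H}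
    (hw : IsMinuscule b θ J w) (hr : w (affRoot (-θ) 2) = affRoot μ 0) : minRoots b θ v ⊆ J := by
  obtain ⟨w', hw', h2⟩ := exists_minuscule_not_orthogonal hθ hJ hw
  rw [hr] at h2
  rw [isMinuscule_iff] at hw'
  obtain ⟨hw', hinv⟩ := hw'
  have h1 : w' (affRoot (-θ) 1) = affRoot μ (-1) := by
    have := affWeyl_apply_affRoot_add hw' h2 (-1)
    rwa [zero_add] at this
  -- The only inversions of `u = w' s₀` are finite roots that pair to `1` with the coroot of `θ`.
  have hu : w' * affRefl (-θ) 1 ∈ affWeyl b θ :=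
    mul_mem hw' (affRefl_mem_affWeyl (p := (-θ, 1)) (.inr rfl))
  have key : ∀ (κ : H.root) (k : ℤ), affRoot κ k ∈ affInv b (w' * affRefl (-θ) 1) →
      k = 0 ∧ pr κ θ = 1 := by
    rintro κ k ⟨e1, e2⟩
    rw [LinearEquiv.mul_apply] at e2
    by_cases he : affRoot κ k = affRoot (-θ) 1
    · rw [he, affRefl_affRoot_self, map_neg, neg_neg, h1, affRoot_mem_affPos] at e2
      omega
    · have e3 := hθ.affRefl_zero_mem e1 he
      rw [affRefl_zero] at e2 e3
      obtain ⟨e4, e5, e6⟩ := (hinv _ _).1 ⟨e3, e2⟩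
      rw [pr_neg_left, pr_sr_self, neg_neg] at e6
      have e7 := hθ.pr_nonneg (hJ _ e5)
      rw [pr_neg_left, pr_sr_self, neg_neg] at e7
      rw [affRoot_mem_affPos] at e1
      omega
  obtain ⟨v', hv'⟩ := exists_weyl_eq hθ hu fun κ k h => (key κ k h).1
  have hmin : IsMinRep b θ μ v' := by
    constructor
    · have := hv' θ 0
      rw [LinearEquiv.mul_apply, affRefl_zero, sr_self, pr_self, zero_add, h2] at this
      exact (affRoot_inj.1 this).1.symm
    · intro γ hγ h0
      by_contra hn
      have := (key γ 0 ⟨affRoot_mem_affPos.2 (.inr ⟨rfl, hγ⟩), by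
        rw [hv', neg_affRoot_mem_affPos]
        exact .inr ⟨rfl, hn⟩⟩).2
      omega
  -- So `u` is `v`, and the inversions of `w' = v s₀` are as claimed.
  obtain rfl := hv.unique hθ hmin
  suffices ∀ γ ∈ minRoots b θ v, affRoot (-γ) 1 ∈ affInv b w' from fun γ hγ => by
    have := ((hinv _ _).1 (this γ hγ)).2.1
    rwa [neg_neg] at this
  rintro γ (rfl | ⟨e1, e2⟩)
  · refine ⟨affRoot_mem_affPos.2 (.inl le_rfl), ?_⟩
    rw [h1, neg_affRoot_mem_affPos]
    exact .inl le_rfl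
  · refine ⟨affRoot_mem_affPos.2 (.inl le_rfl), ?_⟩
    have := hv' (sr θ (-γ)) (1 + pr (-γ) θ)
    rw [LinearEquiv.mul_apply, affRefl_zero, sr_sr, pr_sr_self, add_neg_cancel_right] at this
    have e3 : sr θ (-γ) = -sr θ γ := by
      rw [← root_inj, root_sr, root_neg, root_neg, root_sr, pr_neg_left, neg_smul]
      abel
    rw [this, pr_neg_left, e1, e3, act_neg, neg_affRoot_mem_affPos, isPos_neg]
    exact .inr ⟨rfl, fun h => h e2⟩

/-- The finite Weyl group embeds in the affine one, acting on `γ + kδ` through `γ`. -/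
lemma exists_affine_lift (b : (rootSystem H).Base) (θ : H.root) (v : Weyl H) :
    ∃ g ∈ affWeyl b θ, ∀ (γ : H.root) (k : ℤ), g (affRoot γ k) = affRoot (act v γ) k := by
  obtain ⟨l, hl, rfl⟩ := exists_simple_word b v
  induction l with
  | nil => exact ⟨1, one_mem _, fun γ k => by simp⟩
  | cons α l ih =>
    obtain ⟨g, h1, h2⟩ := ih fun β h => hl β (by simp [h])
    refine ⟨affRefl α 0 * g, mul_mem (affRefl_mem_affWeyl (p := (α, 0))
      (.inl ⟨hl α (by simp), rfl⟩)) h1, fun γ k => ?_⟩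
    rw [LinearEquiv.mul_apply, h2, affRefl_affRoot, mul_zero, sub_zero, List.map_cons,
      List.prod_cons, act_mul, act_ofIdx]

/-- The minuscule element of the ideal attached to `v` is `v s₀`. -/
lemma exists_isMinuscule_minRoots (hθ : IsHighestRoot b θ) (hμ : b.IsPos μ)
    (hv : IsMinRep b θ μ v) :
    ∃ w, IsMinuscule b θ (minRoots b θ v) w ∧ w (affRoot (-θ) 2) = affRoot μ 0 := by
  obtain ⟨g, hg, hgv⟩ := exists_affine_lift b θ v
  have happ : ∀ (γ : H.root) (k : ℤ), (g * affRefl (-θ) 1) (affRoot γ k) =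
      affRoot (act v (sr θ γ)) (k + pr γ θ) := fun γ k => by
    rw [LinearEquiv.mul_apply, affRefl_zero, hgv]
  have hsr : sr θ (-θ) = θ := by rw [← sr_self, sr_sr]
  refine ⟨g * affRefl (-θ) 1, isMinuscule_iff.2 ⟨mul_mem hg
    (affRefl_mem_affWeyl (p := (-θ, 1)) (.inr rfl)), fun κ k => ?_⟩, ?_⟩
  · simp only [affInv, Set.mem_ofPred_eq]
    rw [happ, neg_affRoot_mem_affPos, affRoot_mem_affPos]
    have e3 : sr θ (-κ) = -sr θ κ := by
      rw [← root_inj, root_sr, root_neg, root_neg, root_sr, pr_neg_left, neg_smul]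
      abel
    constructor
    · rintro ⟨h1, h2⟩
      rcases h1 with h1 | ⟨rfl, h1⟩
      · by_cases he : κ = -θ
        · subst he
          rw [hsr, hv.act_eq, pr_neg_left, pr_self] at h2
          refine ⟨?_, by rw [neg_neg]; exact self_mem_minRoots⟩
          rcases h2 with h2 | ⟨-, h2⟩
          · omega
          · exact absurd hμ h2
        · have h3 : ¬ pr κ θ ≤ -2 := fun h => he (hθ.eq_neg_of_le h)
          have h4 : k = 1 ∧ pr κ θ = -1 := by omega
          have h5 : ¬ b.IsPos (act v (sr θ κ)) := by
            rcases h2 with h2 | h2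
            · omega
            · exact h2.2
          refine ⟨h4.1, .inr ⟨by rw [pr_neg_left]; omega, ?_⟩⟩
          rwa [e3, act_neg, isPos_neg]
      · have h3 := hθ.pr_nonneg h1
        have h4 : pr κ θ = 0 := by omega
        rw [sr_of_pr_eq_zero h4] at h2
        exact absurd (hv.isPos κ h1 h4) (h2.resolve_left (by omega)).2
    · rintro ⟨rfl, h⟩
      refine ⟨.inl le_rfl, ?_⟩
      rcases h with h | ⟨h1, h2⟩
      · rw [neg_eq_iff_eq_neg.1 h, pr_neg_left, pr_self]
        exact .inl (by omega)
      · rw [e3, act_neg, isPos_neg] at h2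
        rw [pr_neg_left] at h1
        exact .inr ⟨by omega, h2⟩
  · rw [happ, hsr, hv.act_eq, pr_neg_left, pr_self]
    rfl

/-- The ideal with roots `minRoots b θ v` is the least one with rootlet `μ`. -/
lemma exists_isRootMinimal (hθ : IsHighestRoot b θ) (hμ : b.IsPos μ) (hv : IsMinRep b θ μ v) :
    ∃ 𝔞 : LieSubalgebra ℂ L, IsRootMinimal b θ μ 𝔞 ∧
      leviSimple b 𝔞 = stabSimple b (minRoots b θ v) := by
  have hpos : ∀ γ ∈ minRoots b θ v, b.IsPos γ := fun γ h => hθ.isPos_of_mem_minRoots h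
  have hup : ∀ γ ∈ minRoots b θ v, ∀ α κ : H.root, b.IsPos α → rt κ = rt α + rt γ →
      κ ∈ minRoots b θ v := fun γ hγ α κ hα h => minRoots_add hθ hv hγ hα h
  obtain ⟨𝔞, h1, h2⟩ := exists_isAbelianIdeal hpos hup
    fun γ hγ γ' hγ' κ => minRoots_add_ne hθ hμ hv hγ hγ'
  have hI : idealRoots b 𝔞 = minRoots b θ v := idealRoots_eq hpos h1
  obtain ⟨w, hw, hr⟩ := exists_isMinuscule_minRoots hθ hμ hv
  refine ⟨𝔞, ⟨⟨h2, ?_, w, by rwa [hI], ?_⟩, ?_⟩, leviSimple_eq_stabSimple hpos hup h1⟩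
  · rintro rfl
    have h3 : θ ∈ idealRoots b (⊥ : LieSubalgebra ℂ L) := hI ▸ self_mem_minRoots
    obtain ⟨x, hx, hx0⟩ := θ.1.exists_ne_zero
    exact hx0 (by simpa using h3.2 hx)
  · rw [two_smul_delta_sub_emb, hr, emb_eq]
  · rintro 𝔠 ⟨-, -, w', hw', hr'⟩
    rw [two_smul_delta_sub_emb, emb_eq] at hr'
    exact le_of_subset_idealRoots h1 (minRoots_subset hθ hv (fun γ h => h.1) hw' hr')

/-! ### The types A and C -/

/-- Some simple root is as long as `θ`, because `θ` is conjugate to a simple root. -/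
lemma exists_simple_length_eq (hθ : IsHighestRoot b θ) :
    ∃ α ∈ b.support, rootIp θ θ = rootIp α α := by
  refine hθ.1.induction_on_reflect
    (p := fun γ => ∃ α ∈ b.support, rootIp γ γ = rootIp α α) (fun α hα => ⟨α, hα, rfl⟩) ?_
  rintro γ β ⟨α, hα, h⟩ -
  refine ⟨α, hα, ?_⟩
  change rootIp (sr β γ) (sr β γ) = _
  rw [← act_ofIdx, rootIp_act, h]

lemma pr_sr (β κ α : H.root) : pr (sr β κ) α = pr κ α - pr κ β * pr β α := by
  have h := RootPairing.pairingIn_eq_add_of_root_eq_smul_add_smul (P := rootSystem H) (S := ℤ)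
    (i := κ) (j := α) (k := sr β κ) (l := β) (x := 1) (y := -pr κ β)
    (by rw [root_sr, one_smul, neg_smul, sub_eq_add_neg])
  rw [h]
  simp [sub_eq_add_neg]

lemma even_pr_act (b : (rootSystem H).Base) (w : Weyl H) {γ : H.root}
    (h : ∀ α ∈ b.support, Even (pr γ α)) : ∀ α ∈ b.support, Even (pr (act w γ) α) := by
  obtain ⟨l, hl, rfl⟩ := exists_simple_word b w
  induction l with
  | nil => simpa using h
  | cons β l ih =>
    intro α hα
    have h1 := ih fun α hα => hl α (by simp [hα])
    have hβ := hl β (by simp)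
    rw [List.map_cons, List.prod_cons, act_mul, act_ofIdx]
    set κ := act _ γ
    rw [pr_sr]
    exact (h1 α hα).sub ((h1 β hβ).mul_right _)

/-- In type C the long roots pair evenly with all simple coroots, whereas `θ` pairs to `1` with the
simple root `θ - v⁻¹ θ` if `μ = v θ` is neither `θ` nor orthogonal to `θ`. -/
lemma not_hasCartanMatrix_C (hθ : IsHighestRoot b θ) (hμ : b.IsPos μ) (hl : IsLong μ)
    (hv : IsMinRep b θ μ v) (h0 : pr μ θ ≠ 0) (hne : μ ≠ θ) {n : ℕ} (e : Fin n ≃ b.support) :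
    ¬ HasCartanMatrix b (CartanMatrix.C n) e := by
  intro hC
  obtain ⟨x, hx, h1, h2⟩ := exists_simple_act_eq hθ hμ hv h0 hne
  have hlθ : IsLong θ := fun ν => (hl ν).trans_eq (rootIp_self_eq hv.act_eq)
  -- `x = -v⁻¹ s_μ θ` is conjugate to `θ`, so `⟨θ, x^∨⟩ = ⟨x, θ^∨⟩ = 1`.
  have h3 : pr θ x = 1 := by
    have e1 := hθ.pr_nonneg hμ
    have e2 := hθ.pr_le_one hne
    have e3 : pr θ μ = 1 := by rw [pr_comm_of_act_eq hv.act_eq]; omega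
    have e4 : act (v⁻¹ * RootPairing.weylGroup.ofIdx (rootSystem H) μ *
        RootPairing.weylGroup.ofIdx (rootSystem H) θ) θ = x := by
      rw [act_mul, act_mul, act_ofIdx, act_ofIdx, ← act_inv_act v x]
      congr 1
      rw [← root_inj, h2, sr_self, root_sr, pr_neg_left, e3, root_neg, neg_smul, one_smul]
      abel
    rw [pr_comm_of_act_eq e4, h1]
  -- Lengths do not decrease along the numbering, so the last simple root is long.
  have key : ∀ (m : ℕ) (k : Fin n), k.val + m + 1 = n → IsLong (e k).1 →
      ∃ k : Fin n, k.val + 1 = n ∧ IsLong (e k).1 := by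
    intro m
    induction m with
    | zero => exact fun k hk h => ⟨k, hk, h⟩
    | succ m ih =>
      intro k hk h
      refine ih ⟨k.val + 1, by omega⟩ (by simp only; omega) fun ν => (h ν).trans ?_
      have e1 := two_mul_rootIp (e k).1 (e ⟨k.val + 1, by omega⟩).1
      have e2 := two_mul_rootIp (e ⟨k.val + 1, by omega⟩).1 (e k).1
      rw [hC, rootIp_comm] at e1
      rw [hC] at e2
      have e3 : CartanMatrix.C n k ⟨k.val + 1, by omega⟩ = -1 := by
        simp [CartanMatrix.C, Fin.ext_iff]
      have e4 : CartanMatrix.C n ⟨k.val + 1, by omega⟩ k ≤ -1 := by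
        simp only [CartanMatrix.C, Matrix.of_apply, Fin.ext_iff]
        split_ifs <;> omega
      have e5 : (CartanMatrix.C n ⟨k.val + 1, by omega⟩ k : ℝ) ≤ -1 := by exact_mod_cast e4
      rw [e3] at e1
      push_cast at e1
      have e6 := rootIp_self_pos (e k).1
      nlinarith
  obtain ⟨α, hα, h4⟩ := exists_simple_length_eq hθ
  obtain ⟨k, hk⟩ := e.surjective ⟨α, hα⟩
  obtain ⟨m, hm, hlong⟩ := key (n - 1 - k.val) k (by omega) fun ν => by
    rw [hk, ← h4]
    exact hlθ ν
  obtain ⟨w, hw⟩ := exists_act_eq hθ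
    (RootPairing.Base.isPos_of_mem_support (e m).2) hlong
  -- It pairs evenly with all simple coroots, and so does its conjugate `θ`.
  have h5 := even_pr_act b w⁻¹ (γ := (e m).1) (fun β hβ => by
    obtain ⟨l, hl⟩ := e.surjective ⟨β, hβ⟩
    have e1 := hC m l
    rw [hl] at e1
    rw [e1]
    simp only [CartanMatrix.C, Matrix.of_apply, Fin.ext_iff]
    split_ifs <;> first | decide | omega) x hx
  rw [← hw, act_inv_act, h3] at h5
  exact absurd h5 (by decide)

section TypeA

/-- `a 0, …, a n` are simple roots that form a Dynkin diagram of type A, numbered along the diagram;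
the other values of the sequence `a` are irrelevant. -/
structure IsChain (b : (rootSystem H).Base) (n : ℕ) (a : ℕ → H.root) : Prop where
  mem : ∀ k ≤ n, a k ∈ b.support
  pr_eq_zero : ∀ k ≤ n, ∀ l ≤ n, k ≠ l → k + 1 ≠ l → l + 1 ≠ k → pr (a k) (a l) = 0
  pr_succ : ∀ k < n, pr (a k) (a (k + 1)) = -1
  succ_pr : ∀ k < n, pr (a (k + 1)) (a k) = -1

/-- The sum of the first `j` members of a sequence of roots. -/
def partialSum (a : ℕ → H.root) (j : ℕ) : Module.Dual ℂ H := ∑ m ∈ Finset.range j, rt (a m)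

lemma partialSum_succ (a : ℕ → H.root) (j : ℕ) :
    partialSum a (j + 1) = partialSum a j + rt (a j) := Finset.sum_range_succ _ _

variable {n : ℕ} {a : ℕ → H.root}

lemma ofIdx_smul_root (α γ : H.root) : RootPairing.weylGroup.ofIdx (rootSystem H) α • rt γ =
    rt γ - pr γ α • rt α := by
  rw [← root_act, act_ofIdx, root_sr]

namespace IsChain

lemma htLin_partialSum (ha : IsChain b n a) {j : ℕ} (hj : j ≤ n + 1) :
    htLin b (partialSum a j) = j := by
  rw [partialSum, map_sum, Finset.sum_congr rfl fun m hm =>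
    htLin_simple (ha.mem m (by have := Finset.mem_range.1 hm; omega))]
  simp

/-- In type A the reflection in `a k`, for `k > 0`, acts on the partial sums by swapping those of
index `k` and `k + 1`. -/
lemma ofIdx_smul_partialSum (ha : IsChain b n a) {k : ℕ} (hk : 0 < k) (hkn : k ≤ n) {j : ℕ}
    (hj : j ≤ n + 1) : RootPairing.weylGroup.ofIdx (rootSystem H) (a k) • partialSum a j =
      partialSum a (if j = k then k + 1 else if j = k + 1 then k else j) := by
  induction j with
  | zero =>
    rw [if_neg (by omega), if_neg (by omega)]
    simp [partialSum]
  | succ j ih =>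
    rw [partialSum_succ, smul_add, ih (by omega), ofIdx_smul_root]
    obtain h | h | h | h | h : j + 1 < k ∨ j + 1 = k ∨ j = k ∨ j = k + 1 ∨ k + 1 < j := by omega
    · rw [if_neg (by omega), if_neg (by omega), if_neg (by omega), if_neg (by omega),
        ha.pr_eq_zero j (by omega) k hkn (by omega) (by omega) (by omega), partialSum_succ]
      simp
    · subst h
      rw [if_neg (by omega), if_neg (by omega), if_pos rfl, ha.pr_succ j (by omega),
        partialSum_succ, partialSum_succ, neg_smul, one_smul]
      abel
    · subst h
      rw [if_pos rfl, if_neg (by omega), if_pos rfl, pr_self, partialSum_succ, two_smul]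
      abel
    · subst h
      rw [if_neg (by omega), if_pos rfl, if_neg (by omega), if_neg (by omega),
        ha.succ_pr k (by omega), partialSum_succ, partialSum_succ, neg_smul, one_smul]
      abel
    · rw [if_neg (by omega), if_neg (by omega), if_neg (by omega), if_neg (by omega),
        ha.pr_eq_zero j (by omega) k hkn (by omega) (by omega) (by omega), partialSum_succ]
      simp

/-- The reflection in `a 0` subtracts `a 0` from the partial sums of at least two roots. -/
lemma ofIdx_zero_smul_partialSum (ha : IsChain b n a) {j : ℕ} (hj : j + 2 ≤ n + 1) :
    RootPairing.weylGroup.ofIdx (rootSystem H) (a 0) • partialSum a (j + 2) =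
      partialSum a (j + 2) - rt (a 0) := by
  induction j with
  | zero =>
    rw [partialSum_succ, partialSum_succ, smul_add, smul_add, ofIdx_smul_root, ofIdx_smul_root,
      pr_self, ha.succ_pr 0 (by omega), two_smul, neg_smul, one_smul]
    simp [partialSum]
  | succ j ih =>
    rw [partialSum_succ, smul_add, ih (by omega), ofIdx_smul_root,
      ha.pr_eq_zero (j + 2) (by omega) 0 (by omega) (by omega) (by omega) (by omega)]
    simp only [zero_smul]
    abel

/-- The cycle `s_{i+1} ⋯ s_n`, acting on the partial sums: it takes the sum of all `n + 1` roots to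
the sum of the first `i + 1` and shifts the partial sums in between. -/
lemma exists_cycle (ha : IsChain b n a) {i : ℕ} (hi : i ≤ n) : ∃ v : Weyl H, ∀ j ≤ n + 1,
    v • partialSum a j =
      partialSum a (if j ≤ i then j else if j = n + 1 then i + 1 else j + 1) := by
  induction hi using Nat.decreasingInduction with
  | self =>
    refine ⟨1, fun j hj => ?_⟩
    rw [one_smul]
    congr 1
    split_ifs <;> omega
  | of_succ i hi ih =>
    obtain ⟨v, hv⟩ := ih
    refine ⟨RootPairing.weylGroup.ofIdx (rootSystem H) (a (i + 1)) * v, fun j hj => ?_⟩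
    rw [mul_smul, hv j hj, ha.ofIdx_smul_partialSum (by omega) (by omega)
      (by split_ifs <;> omega)]
    congr 1
    split_ifs <;> omega

lemma pr_of_smul_eq {α γ : H.root} {c : ℤ}
    (h : RootPairing.weylGroup.ofIdx (rootSystem H) α • rt γ = rt γ - c • rt α) : pr γ α = c := by
  rw [ofIdx_smul_root, sub_right_inj] at h
  exact smul_left_injective ℤ ((rootSystem H).ne_zero α) h

/-- If the sum of all simple roots is a long root, then it is dominant, hence the highest root;
it is orthogonal to all simple roots but the first and the last. -/
lemma eq_highest (ha : IsChain b n a) (hn : 0 < n) (hs : ∀ α ∈ b.support, ∃ k ≤ n, α = a k)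
    (hθ : IsHighestRoot b θ) {ν : H.root} (hl : IsLong ν) (hν : rt ν = partialSum a (n + 1)) :
    ν = θ ∧ pr ν (a 0) = 1 ∧ pr ν (a n) = 1 ∧ ∀ k, 0 < k → k < n → pr ν (a k) = 0 := by
  have h0 : pr ν (a 0) = 1 := pr_of_smul_eq (by
    obtain ⟨m, rfl⟩ : ∃ m, n = m + 1 := ⟨n - 1, by omega⟩
    rw [hν, ha.ofIdx_zero_smul_partialSum le_rfl, one_smul])
  have h1 : pr ν (a n) = 1 := pr_of_smul_eq (by
    rw [hν, ha.ofIdx_smul_partialSum hn le_rfl le_rfl, if_neg (by omega), if_pos rfl,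
      partialSum_succ, one_smul, add_sub_cancel_right])
  have h2 : ∀ k, 0 < k → k < n → pr ν (a k) = 0 := fun k hk hkn => pr_of_smul_eq (by
    rw [hν, ha.ofIdx_smul_partialSum hk hkn.le le_rfl, if_neg (by omega), if_neg (by omega),
      zero_smul, sub_zero])
  refine ⟨eq_highest_of_dominant hθ ?_ hl fun α hα => ?_, h0, h1, h2⟩
  · have := htLin_root (b := b) ν
    rw [hν, ha.htLin_partialSum le_rfl] at this
    have h3 : ((n + 1 : ℕ) : ℤ) = b.height ν := by exact_mod_cast this
    exact height_pos.1 (by omega)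
  · obtain ⟨k, hk, rfl⟩ := hs α hα
    rcases Nat.eq_zero_or_pos k with rfl | hk0
    · omega
    · rcases hk.eq_or_lt with rfl | hkn
      · omega
      · exact (h2 k hk0 hkn).ge

/-- The cycle of `exists_cycle` takes `θ` to `μ`, the sum of the first `i + 1` simple roots, and is
the minimal element doing so; it takes the last simple root to `μ - θ`, and among the other simple
roots orthogonal to `θ` only `a i` has an image that is not simple. -/
lemma stabSimple_eq (ha : IsChain b n a) (hinj : ∀ k ≤ n, ∀ l ≤ n, a k = a l → k = l)
    (hs : ∀ α ∈ b.support, ∃ k ≤ n, α = a k)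
    (hθ : IsHighestRoot b θ) (hμ : b.IsPos μ) (hl : IsLong μ) (hv : IsMinRep b θ μ v)
    {i : ℕ} (hi : i < n) (hμi : rt μ = partialSum a (i + 1)) :
    stabSimple b (minRoots b θ v) = {a n} ∪ transported b v μ ∧
      stabSimple b (minRoots b θ v) = (b.support : Set H.root) \ {a 0, a i} := by
  obtain ⟨v', hv'⟩ := ha.exists_cycle hi.le
  have htop : v' • partialSum a (n + 1) = rt μ := by
    rw [hv' _ le_rfl, if_neg (by omega), if_pos rfl, hμi]
  obtain ⟨hθe, p0, pn, pk⟩ := ha.eq_highest (by omega) hs hθ (isLong_act v'⁻¹ hl)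
    (by rw [root_act, ← htop, inv_smul_smul])
  rw [hθe] at p0 pn pk
  have hθn : rt θ = partialSum a (n + 1) := by
    rw [← hθe, root_act, ← htop, inv_smul_smul]
  have hsmul : ∀ k ≤ n, rt (act v' (a k)) =
      v' • partialSum a (k + 1) - v' • partialSum a k := fun k hk => by
    rw [root_act, partialSum_succ, smul_add, add_sub_cancel_left]
  have hlast : rt (act v' (a n)) = rt μ - rt θ := by
    rw [hsmul n le_rfl, htop, hv' n (by omega), if_neg (by omega), if_neg (by omega), hθn]
  have hlow : ∀ k < i, act v' (a k) = a k := fun k hk => by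
    rw [← root_inj, hsmul k (by omega), hv' _ (by omega), hv' _ (by omega), if_pos (by omega),
      if_pos (by omega), partialSum_succ, add_sub_cancel_left]
  have hhigh : ∀ k, i < k → k < n → act v' (a k) = a (k + 1) := fun k hk hkn => by
    rw [← root_inj, hsmul k (by omega), hv' _ (by omega), hv' _ (by omega), if_neg (by omega),
      if_neg (by omega), if_neg (by omega), if_neg (by omega), partialSum_succ,
      add_sub_cancel_left]
  have hmid : rt (act v' (a i)) = rt (a i) + rt (a (i + 1)) := by
    rw [hsmul i hi.le, hv' _ (by omega), hv' _ (by omega), if_neg (by omega),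
      if_neg (by omega), if_pos le_rfl, partialSum_succ, partialSum_succ]
    abel
  have hpos : ∀ k ≤ n, b.IsPos (a k) := fun k hk =>
    RootPairing.Base.isPos_of_mem_support (ha.mem k hk)
  have hmid' : b.IsPos (act v' (a i)) := by
    rw [← height_pos, b.height_add hmid]
    have := height_pos.2 (hpos i hi.le)
    have := height_pos.2 (hpos (i + 1) (by omega))
    omega
  have hmin : IsMinRep b θ μ v' := by
    refine ⟨root_inj.1 (by rw [root_act, hθn, htop]), fun γ hγ h0 =>
      isPos_of_forall_simple_orthogonal hθ (fun α hα h0 => ?_) hγ h0⟩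
    obtain ⟨k, hk, rfl⟩ := hs α hα
    have hkn : k ≠ n := by
      rintro rfl
      rw [pr_eq_zero_comm] at h0
      omega
    rcases lt_trichotomy k i with h | rfl | h
    · rw [hlow k h]
      exact hpos k hk
    · exact hmid'
    · rw [hhigh k h (by omega)]
      exact hpos _ (by omega)
  obtain rfl := hv.unique hθ hmin
  have hn0 : pr (a n) θ ≠ 0 := fun h => by
    rw [pr_eq_zero_comm] at h
    omega
  have hunion := stabSimple_eq_union hθ hμ hv (ha.mem n le_rfl) hn0 hlast
  refine ⟨hunion, ?_⟩
  rw [hunion, transported_eq hθ hv]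
  ext α
  simp only [Set.singleton_union, Set.mem_insert_iff, Set.mem_ofPred_eq, Set.mem_sdiff,
    Set.mem_singleton_iff, SetLike.mem_coe, rootIp_eq_zero, not_or]
  constructor
  · rintro (rfl | ⟨h1, h2, h3⟩)
    · refine ⟨ha.mem n le_rfl, fun h => ?_, fun h => ?_⟩
      · have := hinj _ le_rfl _ (Nat.zero_le _) h
        omega
      · have := hinj _ le_rfl _ hi.le h
        omega
    · refine ⟨h1, ?_, ?_⟩
      · rintro rfl
        rw [pr_eq_zero_comm] at h3
        omega
      · rintro rfl
        exact notMem_support_of_eq_add (hpos i hi.le) (hpos _ (by omega)) hmid h2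
  · rintro ⟨h1, h2, h3⟩
    obtain ⟨k, hk, rfl⟩ := hs α h1
    rcases hk.eq_or_lt with rfl | hkn
    · exact .inl rfl
    · have hk0 : k ≠ 0 := fun h => h2 (by rw [h])
      have hki : k ≠ i := fun h => h3 (by rw [h])
      refine .inr ⟨h1, ?_, pr_eq_zero_comm.1 (pk k (by omega) hkn)⟩
      rcases lt_or_gt_of_ne hki with h | h
      · rwa [hlow k h]
      · rw [hhigh k h hkn]
        exact ha.mem _ (by omega)

end IsChain

lemma stabSimple_eq_of_typeA (hθ : IsHighestRoot b θ) (hμ : b.IsPos μ) (hl : IsLong μ)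
    (hv : IsMinRep b θ μ v) (e : Fin (n + 1) ≃ b.support)
    (hA : HasCartanMatrix b (CartanMatrix.A (n + 1)) e) {i : Fin (n + 1)} (hi : i ≠ Fin.last n)
    (hμi : rt μ = ∑ k ∈ Finset.Iic i, rt (e k).1) :
    stabSimple b (minRoots b θ v) = {(e (Fin.last n)).1} ∪ transported b v μ ∧
      stabSimple b (minRoots b θ v) = (b.support : Set H.root) \ {(e 0).1, (e i).1} := by
  -- Reduction of `m` modulo `n + 1` extends the numbering to a sequence.
  set a : ℕ → H.root := fun m => (e (Fin.ofNat (n + 1) m)).1 with ha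
  have hak : ∀ k : Fin (n + 1), a k = (e k).1 := fun k => by simp [ha]
  have hval : ∀ k ≤ n, (Fin.ofNat (n + 1) k).val = k := fun k hk =>
    Nat.mod_eq_of_lt (by omega)
  have hchain : IsChain b n a := by
    refine ⟨fun k _ => (e _).2, fun k hk l hl h1 h2 h3 => ?_, fun k hk => ?_, fun k hk => ?_⟩ <;>
    · rw [hA]
      simp only [CartanMatrix.A, Matrix.of_apply, Fin.ext_iff]
      rw [hval _ (by omega), hval _ (by omega)]
      split_ifs <;> omega
  have hin : i.val < n := by
    have := Fin.val_ne_of_ne hi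
    have := i.isLt
    simp only [Fin.val_last] at *
    omega
  have := hchain.stabSimple_eq (v := v) (i := i) (fun k hk l hl h => by
    have := congrArg Fin.val (e.injective (Subtype.ext h))
    rwa [hval k hk, hval l hl] at this) (fun α hα => by
    obtain ⟨k, hk⟩ := e.surjective ⟨α, hα⟩
    exact ⟨k, by omega, by rw [hak, hk]⟩) hθ hμ hl hv hin ?_
  · have h0 := hak 0
    have hn := hak (Fin.last n)
    rw [Fin.val_zero] at h0
    rw [Fin.val_last] at hn
    rwa [h0, hn, hak] at this
  · rw [hμi, partialSum]
    refine Finset.sum_bij (fun k _ => k.val) (fun k hk => ?_) (fun k _ l _ h => Fin.ext h)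
      (fun m hm => ?_) (fun k _ => by rw [hak])
    · have := Fin.le_def.1 (Finset.mem_Iic.1 hk)
      exact Finset.mem_range.2 (by omega)
    · have := Finset.mem_range.1 hm
      exact ⟨⟨m, by omega⟩, Finset.mem_Iic.2 (Fin.le_def.2 (by simp only; omega)), rfl⟩

lemma stabSimple_eq_of_typeA_rev (hθ : IsHighestRoot b θ) (hμ : b.IsPos μ) (hl : IsLong μ)
    (hv : IsMinRep b θ μ v) (e : Fin (n + 1) ≃ b.support)
    (hA : HasCartanMatrix b (CartanMatrix.A (n + 1)) e) {j : Fin (n + 1)} (hj : j ≠ 0)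
    (hμj : rt μ = ∑ k ∈ Finset.Ici j, rt (e k).1) :
    stabSimple b (minRoots b θ v) = {(e 0).1} ∪ transported b v μ ∧
      stabSimple b (minRoots b θ v) =
        (b.support : Set H.root) \ {(e j).1, (e (Fin.last n)).1} := by
  have hA' : HasCartanMatrix b (CartanMatrix.A (n + 1)) (Fin.revPerm.trans e) := fun k l => by
    simp only [Equiv.trans_apply, Fin.revPerm_apply]
    rw [hA]
    simp only [CartanMatrix.A, Matrix.of_apply, Fin.ext_iff, Fin.val_rev]
    split_ifs <;> omega
  have := stabSimple_eq_of_typeA (i := j.rev) hθ hμ hl hv _ hA'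
    (fun h => hj (by rw [← Fin.rev_rev j, h, Fin.rev_last])) (by
    rw [hμj]
    refine Finset.sum_bij (fun k _ => k.rev) (fun k hk => ?_) (fun k _ l _ h => Fin.rev_injective h)
      (fun m hm => ⟨m.rev, ?_, Fin.rev_rev m⟩) (fun k _ => by simp)
    · exact Finset.mem_Iic.2 (Fin.rev_le_rev.2 (Finset.mem_Ici.1 hk))
    · rw [Finset.mem_Ici, ← Fin.rev_le_rev, Fin.rev_rev]
      exact Finset.mem_Iic.1 hm)
  simp only [Equiv.trans_apply, Fin.revPerm_apply, Fin.rev_last, Fin.rev_zero, Fin.rev_rev] at this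
  rwa [Set.pair_comm (e j).1]

end TypeA

end AbelianIdealNormaliser

end

open AbelianIdealNormaliser LieAlgebra LieAlgebra.IsKilling in
theorem theorem2p3 {L : Type*} [LieRing L] [LieAlgebra ℂ L] [FiniteDimensional ℂ L]
    [LieAlgebra.IsSimple ℂ L] (H : LieSubalgebra ℂ L) [H.IsCartanSubalgebra]
    (b : (rootSystem H).Base) (θ : H.root) (hθ : IsHighestRoot b θ)
    (μ : H.root) (hpos : b.IsPos μ) (hlong : IsLong μ) :
    (∃! w : (rootSystem H).weylGroup, IsMinimalTo b θ μ w) ∧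
    (∃ 𝔞 : LieSubalgebra ℂ L, IsRootMinimal b θ μ 𝔞) ∧
    ∀ (w : (rootSystem H).weylGroup) (𝔞 : LieSubalgebra ℂ L),
      IsMinimalTo b θ μ w → IsRootMinimal b θ μ 𝔞 →
      (leviSimple b 𝔞 ∩ {α | rootIp α θ = 0} = transported b w μ ∧
        transported b w μ = {α | α ∈ b.support ∧ act w α ∈ b.support ∧ rootIp α θ = 0}) ∧
      (rootIp μ θ = 0 →
        leviSimple b 𝔞 = transported b w μ ∧ leviSimple b 𝔞 ⊆ {α | rootIp α θ = 0}) ∧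
      (rootIp μ θ ≠ 0 → μ ≠ θ →
        (IsFundamental b θ →
          (∃! α : H.root, α ∈ b.support ∧ rootIp θ α ≠ 0) ∧
          ∀ α ∈ b.support, rootIp θ α ≠ 0 → leviSimple b 𝔞 = {α} ∪ transported b w μ) ∧
        (∀ (n : ℕ) (e : Fin n ≃ b.support), ¬ HasCartanMatrix b (CartanMatrix.C n) e) ∧
        (∀ (n : ℕ) (e : Fin (n + 1) ≃ b.support),
          HasCartanMatrix b (CartanMatrix.A (n + 1)) e →
          (∀ i : Fin (n + 1), i ≠ Fin.last n →
            (rootSystem H).root μ = ∑ k ∈ Finset.Iic i, (rootSystem H).root (e k).1 →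
            leviSimple b 𝔞 = {(e (Fin.last n)).1} ∪ transported b w μ ∧
            leviSimple b 𝔞 = (b.support : Set H.root) \ {(e 0).1, (e i).1}) ∧
          (∀ j : Fin (n + 1), j ≠ 0 →
            (rootSystem H).root μ = ∑ k ∈ Finset.Ici j, (rootSystem H).root (e k).1 →
            leviSimple b 𝔞 = {(e 0).1} ∪ transported b w μ ∧
            leviSimple b 𝔞 =
              (b.support : Set H.root) \ {(e j).1, (e (Fin.last n)).1}))) ∧
      (μ = θ → leviSimple b 𝔞 = {β | β ∈ b.support ∧ rootIp β θ = 0}) := by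
  obtain ⟨v, hvmin, huniq⟩ := existsUnique_isMinimalTo hθ hpos hlong
  have hv : IsMinRep b θ μ v := hvmin.isMinRep hθ
  obtain ⟨𝔠, h𝔠, hlevi⟩ := exists_isRootMinimal hθ hpos hv
  refine ⟨⟨v, hvmin, huniq⟩, ⟨𝔠, h𝔠⟩, fun w 𝔞 hw h𝔞 => ?_⟩
  obtain rfl := huniq w hw
  obtain rfl := h𝔞.unique h𝔠
  rw [hlevi]
  have htr := transported_eq hθ hv
  refine ⟨⟨(stabSimple_inter hθ hpos hv).trans htr.symm, htr⟩, fun h0 => ?_, fun h0 hne => ?_,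
    ?_⟩
  · have h := stabSimple_eq_transported hθ hpos hv (.inl (rootIp_eq_zero.1 h0))
    refine ⟨h, ?_⟩
    rw [h, htr]
    exact fun α hα => hα.2.2
  · have h0' := fun h => h0 (rootIp_eq_zero.2 h)
    refine ⟨?_, fun n e => not_hasCartanMatrix_C hθ hpos hlong hv h0' hne e, fun n e hA =>
      ⟨fun i hi hμi => stabSimple_eq_of_typeA hθ hpos hlong hv e hA hi hμi,
        fun j hj hμj => stabSimple_eq_of_typeA_rev hθ hpos hlong hv e hA hj hμj⟩⟩
    rintro ⟨α, hα, h1, h2⟩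
    have key : ∀ β ∈ b.support, rootIp θ β ≠ 0 → β = α := fun β hβ h => by
      by_contra hne
      exact h (rootIp_eq_zero.2 (h2 β hβ hne))
    refine ⟨⟨α, ⟨hα, fun h => ?_⟩, fun β hβ => key β hβ.1 hβ.2⟩, fun β hβ hβ0 => ?_⟩
    · rw [rootIp_eq_zero, h1] at h
      exact one_ne_zero h
    · obtain ⟨x, hx, h3, h4⟩ := exists_simple_act_eq hθ hpos hv h0' hne
      have h5 : (rootSystem H).pairingIn ℤ x θ ≠ 0 := by omega
      rw [key β hβ hβ0, ← key x hx fun h => h5 (pr_eq_zero_comm.1 (rootIp_eq_zero.1 h))]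
      exact stabSimple_eq_union hθ hpos hv hx h5 h4
  · rintro rfl
    rw [stabSimple_eq_transported hθ hpos hv (.inr rfl)]
    obtain rfl : (1 : Weyl H) = w :=
      IsMinRep.unique hθ ⟨act_one _, fun γ hγ _ => by rwa [act_one]⟩ hv
    ext β
    simp [transported]
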